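/- Let $K\ge 2$ be a fixed number of classes. For each $\nu\in\mathbb N$ let $p=p(\nu)$ be a dimension, $n=n(\nu)$ a sample size, $F=F_\nu$ a probability distribution on $\mathbb R^{p}$, and let $(\mathbf X_1,Y_1),\dots,(\mathbf X_n,Y_n)$ be a sample (all quantities below depend on $\nu$) in which $\mathbf X_1,\dots,\mathbf X_n$ are i.i.d. with law $F$, the labels $Y_i$ take values in $\{1,\dots,K\}$, and $(\mathbf X_i)_{i\le n}$ is independent of $(Y_i)_{i\le n}$. Let $n_k=\#\{i: Y_i=k\}$ and $\hat p_k=n_k/n$. Assume that either, for every $\nu$, the $Y_i$ are i.i.d. with $P(Y_i=k)=p_k>0$ for all $k$, where the $p_k$ do not depend on $\nu$, or, more generally, there is a constant $c>0$ with $P(\min_k\hat p_k\ge c)\to1$ as $\nu\to\infty$ (this includes nonrandom class sizes $n_k\ge cn$). Let $$\mathrm{gCov}_n=\binom n2^{-1}\sum_{1\le i<j\le n}\|\mathbf X_i-\mathbf X_j\|-\sum_{k=1}^K\hat p_k\binom{n_k}2^{-1}\sum_{\substack{i<j\\ Y_i=Y_j=k}}\|\mathbf X_i-\mathbf X_j\|$$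 be the U-statistic sample Gini covariance, where $\|\cdot\|$ is the Euclidean norm, and let $$d(\mathbf x,\mathbf y)=\|\mathbf x-\mathbf y\|-\mathbb E\|\mathbf x-\mathbf X\|-\mathbb E\|\mathbf X-\mathbf y\|+\mathbb E\|\mathbf X-\mathbf X'\|,\qquad \mathbf X,\mathbf X'\ \text{i.i.d. with law } F,$$ be the double-centered distance. In the following expectations $\mathbf X,\mathbf X_1,\dots,\mathbf X_4$ denote independent random vectors with law $F$. Suppose that $\mathbb E d^2(\mathbf X_1,\mathbf X_2)>0$ for every $\nu$ and that - (C1) $\mathbb E\|\mathbf X\|^4<\infty$ for every $\nu$; - (C2) $\dfrac{\mathbb E d^4(\mathbf X_1,\mathbf X_2)}{n\,(\mathbb E d^2(\mathbf X_1,\mathbf X_2))^2}\to0$ as $\nu\to\infty$; - (C3) $\dfrac{\mathbb E\, d(\mathbf X_1,\mathbf X_3)d(\mathbf X_2,\mathbf X_3)d(\mathbf X_1,\mathbf X_4)d(\mathbf X_2,\mathbf X_4)}{(\mathbb E d^2(\mathbf X_1,\mathbf X_2))^2}\to0$ as $\nu\to\infty$. If, as $\nu\to\infty$, $\min\{n_1,\dots,n_K\}\to\infty$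 (in probability, when the $n_k$ are random) and $p\to\infty$, then $$\frac{\mathrm{gCov}_n}{\sigma_0}\ \xrightarrow{\ d\ }\ \mathcal N(0,1),\qquad \sigma_0^2=\Big(\sum_{k=1}^K\hat p_k^2\binom{n_k}2^{-1}-\binom n2^{-1}\Big)\,\mathbb E d^2(\mathbf X_1,\mathbf X_2).$$ Moreover $\sigma_0^2$ is the variance of $\mathrm{gCov}_n$ given the class labels: for every $\nu$ and every label configuration of positive probability with all $n_k\ge2$, the conditional variance of $\mathrm{gCov}_n$ given that configuration equals $\sigma_0^2$. -/

import Mathlib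

open MeasureTheory ProbabilityTheory Filter Topology
open scoped Finset

noncomputable section

namespace GiniCov

/-- The double-centered distance
`d(x, y) = ‖x - y‖ - E‖x - X‖ - E‖X - y‖ + E‖X - X'‖`, with `X, X'` independent of law `F`. -/
def dcDist {p : ℕ} (F : Measure (EuclideanSpace ℝ (Fin p)))
    (x y : EuclideanSpace ℝ (Fin p)) : ℝ :=
  ‖x - y‖ - (∫ z, ‖x - z‖ ∂F) - (∫ z, ‖z - y‖ ∂F) + ∫ w, ‖w.1 - w.2‖ ∂(F.prod F)

/-- `E d(X₁, X₂) ^ m` for `X₁, X₂` independent of law `F`. -/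
def dcMoment {p : ℕ} (F : Measure (EuclideanSpace ℝ (Fin p))) (m : ℕ) : ℝ :=
  ∫ w, dcDist F w.1 w.2 ^ m ∂(F.prod F)

/-- `E d(X₁, X₃) d(X₂, X₃) d(X₁, X₄) d(X₂, X₄)` for `X₁, X₂, X₃, X₄` independent of law `F`
(here `w 0, w 1, w 2, w 3` are `X₁, X₂, X₃, X₄`). -/
def dcCycle {p : ℕ} (F : Measure (EuclideanSpace ℝ (Fin p))) : ℝ :=
  ∫ w : Fin 4 → EuclideanSpace ℝ (Fin p),
    dcDist F (w 0) (w 2) * dcDist F (w 1) (w 2) * dcDist F (w 0) (w 3) * dcDist F (w 1) (w 3)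
    ∂(Measure.pi fun _ => F)

/-- The set of indices of the observations with label `k`. -/
def cls {n K : ℕ} (y : Fin n → Fin K) (k : Fin K) : Finset (Fin n) :=
  Finset.univ.filter fun i => y i = k

/-- The sample size `n_k` of class `k`. -/
def classSize {n K : ℕ} (y : Fin n → Fin K) (k : Fin K) : ℕ := (cls y k).card

/-- The sample proportion `p̂_k = n_k / n`. -/
def classProp {n K : ℕ} (y : Fin n → Fin K) (k : Fin K) : ℝ := (classSize y k : ℝ) / n

/-- The U-statistic estimator of the Gini mean difference from the observations with index
in `S`: the average of `‖x i - x j‖` over the pairs `i < j` in `S`. -/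
def gmdU {n p : ℕ} (x : Fin n → EuclideanSpace ℝ (Fin p)) (S : Finset (Fin n)) : ℝ :=
  ((S.card.choose 2 : ℕ) : ℝ)⁻¹ * ∑ i ∈ S, ∑ j ∈ S with i < j, ‖x i - x j‖

/-- The sample Gini covariance `U_n - ∑ k, p̂_k U_{n_k}` of the sample `(x i, y i)`, `i < n`. -/
def gCov {n p K : ℕ} (x : Fin n → EuclideanSpace ℝ (Fin p)) (y : Fin n → Fin K) : ℝ :=
  gmdU x Finset.univ - ∑ k, classProp y k * gmdU x (cls y k)

/-- `σ₀² = (∑ k, p̂_k² C(n_k, 2)⁻¹ - C(n, 2)⁻¹) E d(X₁, X₂)²`. -/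
def sigmaSq {n p K : ℕ} (F : Measure (EuclideanSpace ℝ (Fin p))) (y : Fin n → Fin K) : ℝ :=
  ((∑ k, classProp y k ^ 2 * (((classSize y k).choose 2 : ℕ) : ℝ)⁻¹) -
    ((n.choose 2 : ℕ) : ℝ)⁻¹) * dcMoment F 2

/-- The labels of the `ν`-th sample are `Y ν i`, `i < n ν`. Either every sample of labels is drawn
independently from one and the same distribution that charges all classes, or the class
proportions stay away from zero with probability tending to one (for instance, the class sizes
are nonrandom and of the same order as `n ν`). -/
def LabelSampling {K : ℕ} (n : ℕ → ℕ) {Ω : ℕ → Type*} [∀ ν, MeasurableSpace (Ω ν)]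
    (μ : ∀ ν, Measure (Ω ν)) (Y : ∀ ν, Fin (n ν) → Ω ν → Fin K) : Prop :=
  ((∀ ν, iIndepFun (Y ν) (μ ν)) ∧
    ∃ π : Fin K → ℝ, (∀ k, 0 < π k) ∧ ∀ ν i k, (μ ν).real {ω | Y ν i ω = k} = π k) ∨
  ∃ c : ℝ, 0 < c ∧
    Tendsto (fun ν => (μ ν).real {ω | ∀ k, c ≤ classProp (fun i => Y ν i ω) k}) atTop (𝓝 1)

end GiniCov

end

/-! Give the pair $i<k$ its coefficient $w_{ik}$ in $\mathrm{gCov}_n$. If every class has at least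
two members, each row of $w$ sums to zero, since both parts of the coefficient contribute $2/n$.
Additive terms $\alpha(x_i)+\alpha(x_k)$ therefore drop out, and
$\mathrm{gCov}_n=\sum_{i<k}w_{ik}\,d(X_i,X_k)$ (`gCov_eq_sum_dcDist`). The kernel $d$ is degenerate,
so for fixed labels the summands are orthogonal. This gives the variance $\sigma_0^2$, and it makes
$\sum_k\big(\sum_{i<k}w_{ik}d(X_i,X_k)\big)$ a sum of martingale differences.

A quantitative martingale CLT (`norm_integral_exp_sub_gaussian_le`) then reduces normality to two
facts about the normalized weights, which are bounded by some $A$. The fourth moments of the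
increments sum to at most $3n^3A^4\,\mathbb E d^4$ (`sum_integral_condMoment_four_le`). The
conditional variance differs from 1 in mean square by at most $2n^3A^4\,\mathbb E
d^4+8n^4A^4\,\mathbb E g^2$, where $g(x,y)=\mathbb E d(x,Z)d(y,Z)$
(`integral_sq_sum_condMoment_sub_le`). Here $\mathbb E g(X_1,X_2)^2$ is the four-cycle moment of
(C3).

When all class proportions are at least $c$, one may take $A^4=64/(c^6n^4(\mathbb E d^2)^2)$, so
these bounds are multiples of the ratios in (C2) and (C3), uniformly over such labels
(`norm_charFun_gCov_sub_le`). Independence allows averaging over the labels. The remaining label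
configurations have vanishing probability (`norm_integral_indep_sub_le`), and Lévy's continuity
theorem concludes. -/

noncomputable section

namespace GiniCov

/-! ### Product measures and resampling of one coordinate -/

section Resampling

variable {ι E : Type*} [Fintype ι] [MeasurableSpace E] {F : Measure E} [IsProbabilityMeasure F]

/-- The law of an i.i.d. sample indexed by `ι`. -/
abbrev sampleLaw (ι : Type*) [Fintype ι] {E : Type*} [MeasurableSpace E] (F : Measure E) :
    Measure (ι → E) := Measure.pi fun _ => F

lemma measurePreserving_pair {i j : ι} (hij : i ≠ j) :
    MeasurePreserving (fun x : ι → E => (x i, x j)) (sampleLaw ι F) (F.prod F) := by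
  have hind : iIndepFun (fun (i : ι) (x : ι → E) => x i) (sampleLaw ι F) :=
    iIndepFun_pi (X := fun _ => id) fun _ => aemeasurable_id
  have h2 := hind.indepFun hij
  rw [indepFun_iff_map_prod_eq_prod_map_map (measurable_pi_apply i).aemeasurable
    (measurable_pi_apply j).aemeasurable] at h2
  refine ⟨by fun_prop, ?_⟩
  rw [h2, (measurePreserving_eval (fun _ : ι => F) i).map_eq,
    (measurePreserving_eval (fun _ : ι => F) j).map_eq]

lemma measurePreserving_eval_prod (i : ι) :
    MeasurePreserving (fun q : (ι → E) × E => (q.1 i, q.2)) ((sampleLaw ι F).prod F)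
      (F.prod F) :=
  (measurePreserving_eval (fun _ : ι => F) i).prod (MeasurePreserving.id F)

variable [DecidableEq ι]

omit [Fintype ι] in
lemma measurable_update_prod (j : ι) :
    Measurable fun q : (ι → E) × E => Function.update q.1 j q.2 := by
  refine measurable_pi_lambda _ fun i => ?_
  by_cases h : i = j
  · subst h; simpa using measurable_snd
  · simp only [ne_eq, h, not_false_eq_true, Function.update_of_ne]
    exact (measurable_pi_apply i).comp measurable_fst

/-- It suffices to compare the measures of boxes: the preimage of a box is a box whose `j`-th side
is freed and reappears as the extra factor. -/
lemma measurePreserving_update_prod (j : ι) :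
    MeasurePreserving (fun q : (ι → E) × E => Function.update q.1 j q.2)
      ((sampleLaw ι F).prod F) (sampleLaw ι F) := by
  refine ⟨measurable_update_prod j, (Measure.pi_eq fun s hs => ?_).symm⟩
  rw [Measure.map_apply (measurable_update_prod j) (MeasurableSet.univ_pi hs)]
  have : (fun q : (ι → E) × E => Function.update q.1 j q.2) ⁻¹' Set.univ.pi s =
      (Set.univ.pi (Function.update s j Set.univ)) ×ˢ s j := by
    ext q
    simp only [Set.mem_preimage, Set.mem_univ_pi, Set.mem_prod]
    constructor
    · intro h
      refine ⟨fun i => ?_, by simpa using h j⟩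
      by_cases hi : i = j
      · subst hi; simp
      · simpa [Function.update_of_ne hi] using h i
    · rintro ⟨h1, h2⟩ i
      by_cases hi : i = j
      · subst hi; simpa using h2
      · simpa [Function.update_of_ne hi] using h1 i
  rw [this, Measure.prod_prod, Measure.pi_pi]
  rw [← Finset.mul_prod_erase _ _ (Finset.mem_univ j),
    ← Finset.mul_prod_erase _ (fun i => F (s i)) (Finset.mem_univ j)]
  simp only [Function.update_self, measure_univ, one_mul]
  rw [mul_comm]
  congr 1
  refine Finset.prod_congr rfl fun i hi => ?_
  rw [Function.update_of_ne (Finset.ne_of_mem_erase hi)]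

/-- Resampling one coordinate of an i.i.d. sample does not change expectations. -/
lemma integral_resample {G : Type*} [NormedAddCommGroup G] [NormedSpace ℝ G]
    (j : ι) {f : (ι → E) → G} (hf : Integrable f (sampleLaw ι F)) :
    ∫ x, f x ∂sampleLaw ι F = ∫ x, ∫ z, f (Function.update x j z) ∂F ∂sampleLaw ι F := by
  have hm := measurePreserving_update_prod (F := F) j
  have hint : Integrable (fun q : (ι → E) × E => f (Function.update q.1 j q.2))
      ((sampleLaw ι F).prod F) := hm.integrable_comp_of_integrable hf
  rw [← integral_prod _ hint]
  have hf' : AEStronglyMeasurable f (((sampleLaw ι F).prod F).map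
      fun q => Function.update q.1 j q.2) := by
    rw [hm.map_eq]; exact hf.aestronglyMeasurable
  rw [← integral_map hm.measurable.aemeasurable hf', hm.map_eq]

/-- The source of all orthogonality relations below: a product vanishes in mean once one coordinate
enters it through a centered factor only. -/
lemma integral_eq_zero_of_resample {f : (ι → E) → ℝ} (j : ι)
    (hf : Integrable f (sampleLaw ι F))
    (h0 : ∀ x, ∫ z, f (Function.update x j z) ∂F = 0) : ∫ x, f x ∂sampleLaw ι F = 0 := by
  rw [integral_resample j hf]; simp [h0]

end Resampling

/-! ### Fourth and second moments -/

section Integrability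

variable {α : Type*} [MeasurableSpace α] {μ : Measure α}

lemma memLp_four_iff {f : α → ℝ} (hf : AEStronglyMeasurable f μ) :
    MemLp f 4 μ ↔ Integrable (fun x => f x ^ 4) μ := by
  have h := integrable_norm_rpow_iff (p := 4) hf (by norm_num) (by norm_num)
  rw [← h]
  have h4 : (4 : ENNReal).toReal = ((4 : ℕ) : ℝ) := by norm_num
  simp only [h4, Real.rpow_natCast]
  refine integrable_congr (ae_of_all _ fun x => ?_)
  simp only [Real.norm_eq_abs]
  exact Even.pow_abs (by decide) _

lemma _root_.MeasureTheory.MemLp.integrable_pow_of_le_four [IsFiniteMeasure μ] {f : α → ℝ}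
    (hf : MemLp f 4 μ) {k : ℕ} (hk : k ≤ 4) : Integrable (fun x => f x ^ k) μ := by
  have hk' : MemLp f k μ := hf.mono_exponent (by exact_mod_cast hk)
  have h := hk'.integrable_norm_pow'
  refine h.mono' (hf.1.pow k) (ae_of_all _ fun x => ?_)
  simp

lemma _root_.MeasureTheory.MemLp.two_of_four [IsFiniteMeasure μ] {f : α → ℝ}
    (hf : MemLp f 4 μ) : MemLp f 2 μ :=
  hf.mono_exponent (by norm_num)

lemma sq_integral_le [IsProbabilityMeasure μ] {f : α → ℝ} (hf : MemLp f 2 μ) :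
    (∫ x, f x ∂μ) ^ 2 ≤ ∫ x, f x ^ 2 ∂μ := by
  have h := variance_eq_sub hf
  have h0 := variance_nonneg f μ
  simp only [Pi.pow_apply] at h
  linarith

lemma sq_integral_sq_le [IsProbabilityMeasure μ] {f : α → ℝ} (hf : MemLp f 4 μ) :
    (∫ x, f x ^ 2 ∂μ) ^ 2 ≤ ∫ x, f x ^ 4 ∂μ := by
  have h2 : MemLp (fun x => f x ^ 2) 2 μ := by
    refine (memLp_two_iff_integrable_sq (hf.1.pow 2)).2 ?_
    simpa [← pow_mul] using hf.integrable_pow_of_le_four le_rfl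
  simpa [← pow_mul] using sq_integral_le h2

end Integrability

/-! ### Taylor estimates for characteristic functions -/

section Taylor

/-- For $|y|\le1$ this is the remainder of the exponential series. For $|y|\ge1$ every term is
trivially bounded by a multiple of $|y|^3$. The constant is not sharp. -/
lemma norm_exp_mul_I_sub_taylor_le (y : ℝ) :
    ‖Complex.exp (y * Complex.I) - (1 + y * Complex.I - (y ^ 2 / 2 : ℝ))‖ ≤ 4 * |y| ^ 3 := by
  have hn : ‖(y * Complex.I : ℂ)‖ = |y| := by simp
  rcases le_total |y| 1 with h | h
  · have := Complex.exp_bound (x := y * Complex.I) (by rw [hn]; exact h) (n := 3) (by norm_num)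
    rw [hn] at this
    have e : ∑ m ∈ Finset.range 3, (y * Complex.I : ℂ) ^ m / (m.factorial : ℂ) =
        1 + y * Complex.I - (y ^ 2 / 2 : ℝ) := by
      simp only [Finset.sum_range_succ, Finset.sum_range_zero, mul_pow, Complex.I_sq]
      push_cast
      simp [Nat.factorial]
      ring
    rw [e] at this
    refine this.trans ?_
    have : 0 ≤ |y| ^ 3 := by positivity
    norm_num [Nat.factorial]
    nlinarith
  · have h1 : ‖Complex.exp (y * Complex.I) - (1 + y * Complex.I - (y ^ 2 / 2 : ℝ))‖ ≤
        1 + (1 + |y| + y ^ 2 / 2) := by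
      refine (norm_sub_le _ _).trans ?_
      rw [Complex.norm_exp_ofReal_mul_I]
      gcongr
      refine (norm_sub_le _ _).trans ?_
      gcongr
      · refine (norm_add_le _ _).trans ?_
        rw [hn]; simp
      · rw [Complex.norm_real, Real.norm_eq_abs, abs_of_nonneg (by positivity)]
    refine h1.trans ?_
    rw [← sq_abs y]
    nlinarith [mul_nonneg (sub_nonneg.2 h) (sq_nonneg |y|), mul_nonneg (sub_nonneg.2 h)
      (abs_nonneg y)]

lemma abs_one_sub_sub_exp_neg_le {u : ℝ} (hu : 0 ≤ u) : |1 - u - Real.exp (-u)| ≤ u ^ 2 / 2 := by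
  have h1 := Real.one_sub_le_exp_neg u
  have h2 := Real.quadratic_le_exp_of_nonneg hu
  have h3 : Real.exp (-u) ≤ 1 - u + u ^ 2 / 2 := by
    have h4 : Real.exp (-u) * Real.exp u = 1 := by rw [← Real.exp_add]; simp
    have h5 := Real.exp_pos u
    have h6 : 0 < 1 - u + u ^ 2 / 2 := by nlinarith [sq_nonneg (u - 1)]
    by_contra! hc
    -- Contradiction: this product equals $1+u^4/4$.
    have : (1 - u + u ^ 2 / 2) * (1 + u + u ^ 2 / 2) < 1 := by
      calc _ ≤ (1 - u + u ^ 2 / 2) * Real.exp u := mul_le_mul_of_nonneg_left h2 h6.le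
        _ < Real.exp (-u) * Real.exp u := mul_lt_mul_of_pos_right hc h5
        _ = 1 := h4
    nlinarith [pow_nonneg hu 4]
  rw [abs_le]; constructor <;> linarith

variable {E : Type*} [MeasurableSpace E] {F : Measure E} [IsProbabilityMeasure F]

/-- The characteristic function of a centered variable compared with a Gaussian one. -/
lemma norm_integral_exp_sub_exp_le {g : E → ℝ} (hg : MemLp g 4 F) (h0 : ∫ z, g z ∂F = 0)
    (t : ℝ) {ε Δ : ℝ} (hε : 0 < ε) (hΔ : 0 ≤ Δ) (hΔv : Δ ≤ ∫ z, g z ^ 2 ∂F) :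
    ‖∫ z, Complex.exp ((t * g z : ℝ) * Complex.I) ∂F - (Real.exp (-(t ^ 2 / 2 * Δ)) : ℝ)‖ ≤
      2 * |t| ^ 3 * (ε * ∫ z, g z ^ 2 ∂F + ε⁻¹ * ∫ z, g z ^ 4 ∂F) +
        t ^ 2 / 2 * (∫ z, g z ^ 2 ∂F - Δ) + t ^ 4 / 8 * ∫ z, g z ^ 4 ∂F := by
  set v := ∫ z, g z ^ 2 ∂F with hv
  set q := ∫ z, g z ^ 4 ∂F with hq
  have i1 : Integrable g F := by simpa using hg.integrable_pow_of_le_four (k := 1) (by norm_num)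
  have i2 := hg.integrable_pow_of_le_four (k := 2) (by norm_num)
  have i4 := hg.integrable_pow_of_le_four (k := 4) (by norm_num)
  have iexp : Integrable (fun z => Complex.exp ((t * g z : ℝ) * Complex.I)) F := by
    refine Integrable.of_bound (C := 1) ?_ (ae_of_all _ fun z => ?_)
    · refine Complex.continuous_exp.comp_aestronglyMeasurable ?_
      refine AEStronglyMeasurable.mul_const ?_ _
      exact Complex.continuous_ofReal.comp_aestronglyMeasurable (hg.1.const_mul t)
    · rw [Complex.norm_exp_ofReal_mul_I]
  have isq : Integrable (fun z => (t * g z) ^ 2 / 2) F := by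
    have h := i2.const_mul (t ^ 2 / 2)
    have e : (fun z => (t * g z) ^ 2 / 2) = fun z => t ^ 2 / 2 * g z ^ 2 := by ext z; ring
    rwa [e]
  have it : Integrable (fun z => (1 + (t * g z : ℝ) * Complex.I - ((t * g z) ^ 2 / 2 : ℝ) : ℂ)) F := by
    refine ((integrable_const _).add ((i1.const_mul t).ofReal.mul_const _)).sub isq.ofReal
  have eqt : ∫ z, (1 + (t * g z : ℝ) * Complex.I - ((t * g z) ^ 2 / 2 : ℝ) : ℂ) ∂F =
      ((1 - t ^ 2 / 2 * v : ℝ) : ℂ) := by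
    rw [integral_sub, integral_add, integral_mul_const, integral_complex_ofReal, integral_const_mul, h0,
      integral_complex_ofReal]
    · have : ∫ z, (t * g z) ^ 2 / 2 ∂F = t ^ 2 / 2 * v := by
        rw [hv, ← integral_const_mul]; congr 1; ext z; ring
      rw [this]; simp
    · exact integrable_const _
    · exact (i1.const_mul t).ofReal.mul_const _
    · exact (integrable_const _).add ((i1.const_mul t).ofReal.mul_const _)
    · exact isq.ofReal
  have b1 : ‖∫ z, Complex.exp ((t * g z : ℝ) * Complex.I) ∂F - ((1 - t ^ 2 / 2 * v : ℝ) : ℂ)‖ ≤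
      2 * |t| ^ 3 * (ε * v + ε⁻¹ * q) := by
    rw [← eqt, ← integral_sub iexp it]
    refine (norm_integral_le_of_norm_le (g := fun z => 2 * |t| ^ 3 * (ε * g z ^ 2 + ε⁻¹ * g z ^ 4))
      (((i2.const_mul _).add (i4.const_mul _)).const_mul _) (ae_of_all _ fun z => ?_)).trans ?_
    · refine (norm_exp_mul_I_sub_taylor_le _).trans ?_
      rw [abs_mul, mul_pow]
      -- The arithmetic-geometric mean inequality trades the third absolute moment for the second
      -- and fourth, with a free parameter `ε`.
      have : 2 * |g z| ^ 3 ≤ ε * g z ^ 2 + ε⁻¹ * g z ^ 4 := by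
        have e : ε * g z ^ 2 + ε⁻¹ * g z ^ 4 - 2 * |g z| ^ 3 = |g z| ^ 2 * (ε⁻¹ * (ε - |g z|) ^ 2) := by
          rw [← sq_abs (g z), show g z ^ 4 = |g z| ^ 4 from (Even.pow_abs (by decide) _).symm]
          field_simp; ring
        have : 0 ≤ |g z| ^ 2 * (ε⁻¹ * (ε - |g z|) ^ 2) := by positivity
        linarith
      have h3 : 0 ≤ |t| ^ 3 := by positivity
      nlinarith
    · rw [integral_const_mul, integral_add (i2.const_mul _) (i4.const_mul _), integral_const_mul,
        integral_const_mul]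
  have hv2 : Δ ^ 2 ≤ q := (pow_le_pow_left₀ hΔ hΔv 2).trans (sq_integral_sq_le hg)
  -- In the application `Δ` is the increment of a truncated variance and may fall short of `v`; the
  -- deficit `v - Δ` is a separate error term.
  have b2 : |(1 - t ^ 2 / 2 * v) - Real.exp (-(t ^ 2 / 2 * Δ))| ≤
      t ^ 2 / 2 * (v - Δ) + t ^ 4 / 8 * q := by
    have := abs_one_sub_sub_exp_neg_le (u := t ^ 2 / 2 * Δ) (by positivity)
    have h5 : (t ^ 2 / 2 * Δ) ^ 2 / 2 ≤ t ^ 4 / 8 * q := by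
      have : 0 ≤ t ^ 4 := by positivity
      nlinarith
    have h6 : 0 ≤ t ^ 2 / 2 * (v - Δ) := mul_nonneg (by positivity) (by linarith)
    rw [abs_le] at this ⊢
    constructor <;> nlinarith
  calc _ ≤ ‖∫ z, Complex.exp ((t * g z : ℝ) * Complex.I) ∂F - ((1 - t ^ 2 / 2 * v : ℝ) : ℂ)‖ +
        ‖((1 - t ^ 2 / 2 * v : ℝ) : ℂ) - (Real.exp (-(t ^ 2 / 2 * Δ)) : ℝ)‖ :=
        norm_sub_le_norm_sub_add_norm_sub _ _ _
    _ ≤ _ := by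
      rw [← Complex.ofReal_sub, Complex.norm_real, Real.norm_eq_abs]
      linarith

end Taylor

/-! ### A martingale central limit theorem with explicit error -/

section MartingaleCLT

variable {E : Type*} [MeasurableSpace E] {n : ℕ}

/-- The differences `δ k x (x k)` of a martingale adapted to the coordinates of an i.i.d. sample
`x`: `δ k x` depends only on the coordinates before `k`, and `δ k x z` is centered in `z`. -/
structure IsMartingaleDiff (F : Measure E) (δ : Fin n → (Fin n → E) → E → ℝ) : Prop where
  measurable : ∀ k, Measurable fun q : (Fin n → E) × E => δ k q.1 q.2
  memLp : ∀ k, MemLp (fun q : (Fin n → E) × E => δ k q.1 q.2) 4 ((sampleLaw (Fin n) F).prod F)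
  memLp_right : ∀ k x, MemLp (δ k x) 4 F
  centered : ∀ k x, ∫ z, δ k x z ∂F = 0
  adapted : ∀ j k, k ≤ j → ∀ x z, δ k (Function.update x j z) = δ k x

/-- The conditional moments of the martingale differences. -/
def condMoment (F : Measure E) (δ : Fin n → (Fin n → E) → E → ℝ) (m : ℕ) (k : Fin n)
    (x : Fin n → E) : ℝ := ∫ z, δ k x z ^ m ∂F

/-- The first `m` indices. -/
def firstIdx (n m : ℕ) : Finset (Fin n) := Finset.univ.filter fun k => k.val < m

lemma mem_firstIdx {m : ℕ} {k : Fin n} : k ∈ firstIdx n m ↔ k.val < m := by simp [firstIdx]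

lemma firstIdx_zero : firstIdx n 0 = ∅ := by ext; simp [firstIdx]

lemma firstIdx_self : firstIdx n n = Finset.univ := by ext k; simp [firstIdx]

lemma sum_firstIdx_succ {M : Type*} [AddCommMonoid M] (k : Fin n) (f : Fin n → M) :
    ∑ j ∈ firstIdx n (k.val + 1), f j = ∑ j ∈ firstIdx n k.val, f j + f k := by
  have : firstIdx n (k.val + 1) = insert k (firstIdx n k.val) := by
    ext j
    simp only [mem_firstIdx, Finset.mem_insert, Fin.ext_iff]
    omega
  rw [this, Finset.sum_insert (by simp [mem_firstIdx]), add_comm]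

/-- The martingale stopped after `m` steps. -/
def partialSum (δ : Fin n → (Fin n → E) → E → ℝ) (m : ℕ) (x : Fin n → E) : ℝ :=
  ∑ k ∈ firstIdx n m, δ k x (x k)

/-- The predictable quadratic variation after `m` steps. -/
def partialVar (F : Measure E) (δ : Fin n → (Fin n → E) → E → ℝ) (m : ℕ) (x : Fin n → E) : ℝ :=
  ∑ k ∈ firstIdx n m, condMoment F δ 2 k x

/-- The exponential whose expectation is almost constant in `m`. -/
def compensatedExp (F : Measure E) (δ : Fin n → (Fin n → E) → E → ℝ) (t : ℝ) (m : ℕ)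
    (x : Fin n → E) : ℂ :=
  Complex.exp ((t * partialSum δ m x : ℝ) * Complex.I) *
    (Real.exp (t ^ 2 / 2 * min (partialVar F δ m x) 1) : ℝ)

lemma condMoment_two_nonneg (F : Measure E) (δ : Fin n → (Fin n → E) → E → ℝ) (k : Fin n)
    (x : Fin n → E) : 0 ≤ condMoment F δ 2 k x :=
  integral_nonneg fun _ => sq_nonneg _

variable {F : Measure E} [IsProbabilityMeasure F] {δ : Fin n → (Fin n → E) → E → ℝ}

namespace IsMartingaleDiff

variable (hδ : IsMartingaleDiff F δ)
include hδ

lemma measurable_condMoment (m : ℕ) (k : Fin n) : Measurable (condMoment F δ m k) := by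
  have h : StronglyMeasurable fun q : (Fin n → E) × E => δ k q.1 q.2 ^ m :=
    ((hδ.measurable k).pow_const m).stronglyMeasurable
  exact h.integral_prod_right'.measurable

lemma integrable_condMoment {m : ℕ} (hm : m ≤ 4) (k : Fin n) :
    Integrable (condMoment F δ m k) (sampleLaw (Fin n) F) :=
  ((hδ.memLp k).integrable_pow_of_le_four hm).integral_prod_left

omit [IsProbabilityMeasure F] in
lemma condMoment_update {m : ℕ} {j k : Fin n} (h : k ≤ j) (x : Fin n → E) (z : E) :
    condMoment F δ m k (Function.update x j z) = condMoment F δ m k x := by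
  simp only [condMoment, hδ.adapted j k h]

omit [IsProbabilityMeasure F] in
-- The quadratic variation is predictable: it ignores coordinate `k` even with step `k` included,
-- hence the index `k.val + 1`. For the martingale itself, `partialSum_update` has to stop at
-- `k.val`.
lemma partialVar_update (k : Fin n) (x : Fin n → E) (z : E) :
    partialVar F δ (k.val + 1) (Function.update x k z) = partialVar F δ (k.val + 1) x := by
  refine Finset.sum_congr rfl fun j hj => hδ.condMoment_update ?_ x z
  rw [mem_firstIdx] at hj
  exact Fin.le_def.2 (by omega)

omit [IsProbabilityMeasure F] in
lemma partialSum_update (k : Fin n) (x : Fin n → E) (z : E) :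
    partialSum δ k.val (Function.update x k z) = partialSum δ k.val x := by
  refine Finset.sum_congr rfl fun j hj => ?_
  rw [mem_firstIdx] at hj
  rw [hδ.adapted k j (Fin.le_def.2 hj.le), Function.update_of_ne]
  exact fun h => by simp [h] at hj

lemma measurable_partialVar (m : ℕ) : Measurable (partialVar F δ m) :=
  Finset.measurable_fun_sum _ fun k _ => hδ.measurable_condMoment 2 k

lemma integrable_partialVar (m : ℕ) : Integrable (partialVar F δ m) (sampleLaw (Fin n) F) :=
  integrable_finsetSum _ fun k _ => hδ.integrable_condMoment (by norm_num) k

omit [IsProbabilityMeasure F] in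
lemma measurable_diff (k : Fin n) : Measurable fun x : Fin n → E => δ k x (x k) :=
  (hδ.measurable k).comp (measurable_id.prodMk (measurable_pi_apply k))

omit [IsProbabilityMeasure F] in
lemma measurable_partialSum (m : ℕ) : Measurable (partialSum δ m) :=
  Finset.measurable_fun_sum _ fun k _ => hδ.measurable_diff k

lemma measurable_compensatedExp (t : ℝ) (m : ℕ) : Measurable (compensatedExp F δ t m) := by
  have h1 := hδ.measurable_partialSum m
  have h2 := hδ.measurable_partialVar m
  unfold compensatedExp
  fun_prop

omit [IsProbabilityMeasure F] hδ in
lemma exp_min_le (t v : ℝ) : Real.exp (t ^ 2 / 2 * min v 1) ≤ Real.exp (t ^ 2 / 2) := by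
  rw [Real.exp_le_exp]
  exact mul_le_of_le_one_right (by positivity) (min_le_right _ _)

omit [IsProbabilityMeasure F] hδ in
-- The purpose of truncating the variance at 1: the compensator is bounded although the variance
-- process is not.
lemma norm_compensatedExp_le (t : ℝ) (m : ℕ) (x : Fin n → E) :
    ‖compensatedExp F δ t m x‖ ≤ Real.exp (t ^ 2 / 2) := by
  rw [compensatedExp, norm_mul, Complex.norm_exp_ofReal_mul_I, one_mul, Complex.norm_real,
    Real.norm_of_nonneg (Real.exp_pos _).le]
  exact exp_min_le t _

lemma integrable_compensatedExp (t : ℝ) (m : ℕ) :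
    Integrable (compensatedExp F δ t m) (sampleLaw (Fin n) F) :=
  .of_bound (hδ.measurable_compensatedExp t m).aestronglyMeasurable _
    (ae_of_all _ fun x => norm_compensatedExp_le t m x)

/-- After coordinate `k` is resampled, both exponentials contain a common factor `A` free of the new
value. What remains is the characteristic function of one centered increment against `exp (-(t ^ 2 /
2 * Δ))`, which `norm_integral_exp_sub_exp_le` controls. -/
lemma norm_integral_compensatedExp_succ_sub_le (t : ℝ) {ε : ℝ} (hε : 0 < ε) (k : Fin n) :
    ‖∫ x, compensatedExp F δ t (k.val + 1) x ∂sampleLaw (Fin n) F -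
        ∫ x, compensatedExp F δ t k.val x ∂sampleLaw (Fin n) F‖ ≤
      ∫ x, Real.exp (t ^ 2 / 2) * (2 * |t| ^ 3 * (ε * condMoment F δ 2 k x +
        ε⁻¹ * condMoment F δ 4 k x) + t ^ 2 / 2 * (condMoment F δ 2 k x -
          (min (partialVar F δ (k.val + 1) x) 1 - min (partialVar F δ k.val x) 1)) +
          t ^ 4 / 8 * condMoment F δ 4 k x) ∂sampleLaw (Fin n) F := by
  have hV : ∀ m, Integrable (fun x => min (partialVar F δ m x) 1) (sampleLaw (Fin n) F) :=
    fun m => (hδ.integrable_partialVar m).inf (integrable_const 1)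
  have i2 := hδ.integrable_condMoment (m := 2) (by norm_num) k
  have i4 := hδ.integrable_condMoment (m := 4) (by norm_num) k
  have hm := (measurePreserving_update_prod (F := F) k)
  rw [integral_resample k (hδ.integrable_compensatedExp t (k.val + 1)), ← integral_sub _
    (hδ.integrable_compensatedExp t k.val)]
  · refine norm_integral_le_of_norm_le ?_ (ae_of_all _ fun x => ?_)
    · exact ((((i2.const_mul _).add (i4.const_mul _)).const_mul _).add
        ((i2.sub ((hV _).sub (hV _))).const_mul _)).add (i4.const_mul _) |>.const_mul _
    set Δ := min (partialVar F δ (k.val + 1) x) 1 - min (partialVar F δ k.val x) 1 with hΔ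
    set A : ℂ := Complex.exp ((t * partialSum δ k.val x : ℝ) * Complex.I) *
      (Real.exp (t ^ 2 / 2 * min (partialVar F δ (k.val + 1) x) 1) : ℝ) with hA
    have hsucc : partialVar F δ (k.val + 1) x = partialVar F δ k.val x + condMoment F δ 2 k x :=
      sum_firstIdx_succ k _
    have hv := condMoment_two_nonneg F δ k x
    have e1 : ∀ z, compensatedExp F δ t (k.val + 1) (Function.update x k z) =
        A * Complex.exp ((t * δ k x z : ℝ) * Complex.I) := by
      intro z
      have : partialSum δ (k.val + 1) (Function.update x k z) = partialSum δ k.val x + δ k x z := by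
        rw [partialSum, sum_firstIdx_succ, ← partialSum, hδ.partialSum_update,
          hδ.adapted k k le_rfl, Function.update_self]
      rw [compensatedExp, hδ.partialVar_update, this, hA, mul_add, Complex.ofReal_add, add_mul,
        Complex.exp_add]
      ring
    have e2 : compensatedExp F δ t k.val x = A * (Real.exp (-(t ^ 2 / 2 * Δ)) : ℝ) := by
      rw [compensatedExp, hA, mul_assoc, ← Complex.ofReal_mul, ← Real.exp_add]
      congr 4
      rw [hΔ]; ring
    have hAn : ‖A‖ ≤ Real.exp (t ^ 2 / 2) := by
      rw [hA, norm_mul, Complex.norm_exp_ofReal_mul_I, one_mul, Complex.norm_real,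
        Real.norm_of_nonneg (Real.exp_pos _).le]
      exact exp_min_le t _
    simp only [e1]
    rw [integral_const_mul, e2, ← mul_sub, norm_mul]
    have hb := norm_integral_exp_sub_exp_le (hδ.memLp_right k x) (hδ.centered k x) t hε
      (Δ := Δ) ?_ ?_
    · exact mul_le_mul hAn hb (norm_nonneg _) (Real.exp_pos _).le
    · rw [hΔ, hsucc, sub_nonneg]
      exact min_le_min_right _ (by linarith)
    · change Δ ≤ condMoment F δ 2 k x
      rw [hΔ, hsucc]
      rcases le_total (partialVar F δ k.val x) 1 with h | h
      · rw [min_eq_left h]; linarith [min_le_left (partialVar F δ k.val x + condMoment F δ 2 k x) 1]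
      · rw [min_eq_right h]; linarith [min_le_right (partialVar F δ k.val x + condMoment F δ 2 k x) 1]
  · exact (hm.integrable_comp_of_integrable (hδ.integrable_compensatedExp t _)).integral_prod_left

/-- A quantitative martingale central limit theorem. -/
theorem norm_integral_exp_sub_gaussian_le (t : ℝ) {ε : ℝ} (hε : 0 < ε) :
    ‖∫ x, Complex.exp ((t * ∑ k, δ k x (x k) : ℝ) * Complex.I) ∂sampleLaw (Fin n) F -
        (Real.exp (-(t ^ 2 / 2)) : ℝ)‖ ≤
      2 * |t| ^ 3 * ε +
      (2 * |t| ^ 3 * ε + t ^ 2) *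
        ∫ x, |∑ k, condMoment F δ 2 k x - 1| ∂sampleLaw (Fin n) F +
      (2 * |t| ^ 3 * ε⁻¹ + t ^ 4 / 8) *
        ∑ k, ∫ x, condMoment F δ 4 k x ∂sampleLaw (Fin n) F := by
  set P := sampleLaw (Fin n) F
  set V := fun x => ∑ k, condMoment F δ 2 k x with hVdef
  have hVn : ∀ x, partialVar F δ n x = V x := fun x => by rw [partialVar, firstIdx_self]
  have hSn : ∀ x, partialSum δ n x = ∑ k, δ k x (x k) := fun x => by
    rw [partialSum, firstIdx_self]
  have hV : Integrable V P := by
    have := hδ.integrable_partialVar n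
    exact this.congr (ae_of_all _ hVn)
  set R := ∫ x, |V x - 1| ∂P with hR
  set Q := ∑ k, ∫ x, condMoment F δ 4 k x ∂P with hQ
  have hVR : ∫ x, V x ∂P ≤ 1 + R := by
    have : ∫ x, V x ∂P = 1 + ∫ x, (V x - 1) ∂P := by
      rw [integral_sub hV (integrable_const _)]; simp
    rw [this, hR]
    gcongr
    · exact hV.sub (integrable_const _)
    · exact (hV.sub (integrable_const _)).abs
    · exact le_abs_self _
  have hVm : ∀ m, Integrable (fun x => min (partialVar F δ m x) 1) P :=
    fun m => (hδ.integrable_partialVar m).inf (integrable_const 1)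
  -- The integrand is the positive part of `V - 1`.
  have hVR' : ∫ x, V x ∂P - ∫ x, min (V x) 1 ∂P ≤ R := by
    have hi : Integrable (fun x => min (V x) 1) P := hV.inf (integrable_const 1)
    rw [← integral_sub hV hi]
    refine integral_mono (hV.sub hi) (hV.sub (integrable_const _)).abs fun x => ?_
    simp only
    rcases le_total (V x) 1 with h | h
    · rw [min_eq_left h]; simp
    · rw [min_eq_right h]; exact le_abs_self _
  -- the telescoping sum
  have tel : ‖∫ x, compensatedExp F δ t n x ∂P - 1‖ ≤ Real.exp (t ^ 2 / 2) *
      (2 * |t| ^ 3 * (ε * ∫ x, V x ∂P + ε⁻¹ * Q) +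
        t ^ 2 / 2 * (∫ x, V x ∂P - ∫ x, min (V x) 1 ∂P) + t ^ 4 / 8 * Q) := by
    have h0 : ∫ x, compensatedExp F δ t 0 x ∂P = 1 := by
      have : ∀ x, compensatedExp F δ t 0 x = 1 := fun x => by
        simp [compensatedExp, partialSum, partialVar, firstIdx_zero]
      simp [this]
    have h1 := dist_le_range_sum_dist (fun m => ∫ x, compensatedExp F δ t m x ∂P) n
    rw [h0, dist_comm, dist_eq_norm] at h1
    refine h1.trans ?_
    rw [Finset.sum_range]
    have h2 : ∀ k : Fin n, dist (∫ x, compensatedExp F δ t k x ∂P)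
        (∫ x, compensatedExp F δ t (k + 1) x ∂P) ≤ Real.exp (t ^ 2 / 2) *
        (2 * |t| ^ 3 * (ε * ∫ x, condMoment F δ 2 k x ∂P + ε⁻¹ * ∫ x, condMoment F δ 4 k x ∂P) +
        t ^ 2 / 2 * (∫ x, condMoment F δ 2 k x ∂P -
          (∫ x, min (partialVar F δ (k.val + 1) x) 1 ∂P - ∫ x, min (partialVar F δ k.val x) 1 ∂P))
          + t ^ 4 / 8 * ∫ x, condMoment F δ 4 k x ∂P) := by
      intro k
      rw [dist_comm, dist_eq_norm]
      refine (hδ.norm_integral_compensatedExp_succ_sub_le t hε k).trans (le_of_eq ?_)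
      have i2 := hδ.integrable_condMoment (m := 2) (by norm_num) k
      have i4 := hδ.integrable_condMoment (m := 4) (by norm_num) k
      have j1 : Integrable (fun x => 2 * |t| ^ 3 * (ε * condMoment F δ 2 k x +
        ε⁻¹ * condMoment F δ 4 k x)) P := ((i2.const_mul _).add (i4.const_mul _)).const_mul _
      have j2 : Integrable (fun x => t ^ 2 / 2 * (condMoment F δ 2 k x -
          (min (partialVar F δ (k.val + 1) x) 1 - min (partialVar F δ k.val x) 1))) P :=
        (i2.sub ((hVm _).sub (hVm _))).const_mul _
      have j3 : Integrable (fun x => min (partialVar F δ (k.val + 1) x) 1 -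
          min (partialVar F δ k.val x) 1) P := (hVm _).sub (hVm _)
      have j12 : Integrable (fun x => 2 * |t| ^ 3 * (ε * condMoment F δ 2 k x +
          ε⁻¹ * condMoment F δ 4 k x) + t ^ 2 / 2 * (condMoment F δ 2 k x -
          (min (partialVar F δ (k.val + 1) x) 1 - min (partialVar F δ k.val x) 1))) P := j1.add j2
      rw [integral_const_mul, integral_add j12 (i4.const_mul _), integral_add j1 j2,
        integral_const_mul, integral_const_mul, integral_const_mul,
        integral_add (i2.const_mul _) (i4.const_mul _), integral_const_mul, integral_const_mul,
        integral_sub i2 j3, integral_sub (hVm _) (hVm _)]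
    refine (Finset.sum_le_sum fun k _ => h2 k).trans (le_of_eq ?_)
    -- The truncated variances telescope, so the deficits `v - Δ` of all steps add up to the
    -- expectation of `V - min V 1`.
    have h3 : ∑ k : Fin n, (∫ x, min (partialVar F δ (k.val + 1) x) 1 ∂P -
        ∫ x, min (partialVar F δ k.val x) 1 ∂P) = ∫ x, min (V x) 1 ∂P := by
      rw [← Finset.sum_range (fun m => ∫ x, min (partialVar F δ (m + 1) x) 1 ∂P -
        ∫ x, min (partialVar F δ m x) 1 ∂P),
        Finset.sum_range_sub (fun m => ∫ x, min (partialVar F δ m x) 1 ∂P)]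
      have hz : ∀ x, partialVar F δ 0 x = 0 := fun x => by simp [partialVar, firstIdx_zero]
      simp [hVn, hz]
    have h4 : ∑ k, ∫ x, condMoment F δ 2 k x ∂P = ∫ x, V x ∂P := by
      rw [hVdef, integral_finsetSum]
      exact fun k _ => hδ.integrable_condMoment (by norm_num) k
    simp only [← Finset.mul_sum, Finset.sum_add_distrib, Finset.sum_sub_distrib] at h3 ⊢
    rw [h3, h4]
  set φ := ∫ x, Complex.exp ((t * ∑ k, δ k x (x k) : ℝ) * Complex.I) ∂P with hφ
  have hφi : Integrable (fun x => Complex.exp ((t * ∑ k, δ k x (x k) : ℝ) * Complex.I)) P := by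
    refine .of_bound (C := 1) ?_ (ae_of_all _ fun x => ?_)
    · have := hδ.measurable_partialSum n
      simp only [← hSn]
      exact Measurable.aestronglyMeasurable (by fun_prop)
    · rw [Complex.norm_exp_ofReal_mul_I]
  -- The random compensator at the last step is replaced by its value at `V = 1`.
  have cmp : ‖∫ x, compensatedExp F δ t n x ∂P - φ * (Real.exp (t ^ 2 / 2) : ℝ)‖ ≤
      Real.exp (t ^ 2 / 2) * (t ^ 2 / 2 * R) := by
    rw [hφ, ← integral_mul_const, ← integral_sub (hδ.integrable_compensatedExp t n)
      (hφi.mul_const _), hR, ← integral_const_mul, ← integral_const_mul]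
    refine norm_integral_le_of_norm_le
      (((hV.sub (integrable_const _)).abs.const_mul _).const_mul _) (ae_of_all _ fun x => ?_)
    rw [compensatedExp, hSn, hVn, ← mul_sub, norm_mul, Complex.norm_exp_ofReal_mul_I, one_mul,
      ← Complex.ofReal_sub, Complex.norm_real, Real.norm_eq_abs, abs_sub_comm,
      abs_of_nonneg (sub_nonneg.2 (exp_min_le t _))]
    have h5 := Real.one_sub_le_exp_neg (t ^ 2 / 2 - t ^ 2 / 2 * min (V x) 1)
    have h6 : Real.exp (t ^ 2 / 2 * min (V x) 1) = Real.exp (t ^ 2 / 2) *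
        Real.exp (-(t ^ 2 / 2 - t ^ 2 / 2 * min (V x) 1)) := by
      rw [← Real.exp_add]; congr 1; ring
    have h7 : 1 - min (V x) 1 ≤ |V x - 1| := by
      rcases le_total (V x) 1 with h | h
      · rw [min_eq_left h, abs_sub_comm]; exact le_abs_self _
      · rw [min_eq_right h]; simp
    rw [h6]
    calc Real.exp (t ^ 2 / 2) - Real.exp (t ^ 2 / 2) *
          Real.exp (-(t ^ 2 / 2 - t ^ 2 / 2 * min (V x) 1))
        = Real.exp (t ^ 2 / 2) * (1 - Real.exp (-(t ^ 2 / 2 - t ^ 2 / 2 * min (V x) 1))) := by ring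
      _ ≤ Real.exp (t ^ 2 / 2) * (t ^ 2 / 2 * (1 - min (V x) 1)) := by gcongr; linarith
      _ ≤ _ := by gcongr
  -- Multiplying by `exp (-(t ^ 2 / 2))` cancels the prefactor carried by both previous bounds. The
  -- two terms `t ^ 2 / 2 * R`, from truncation and from `cmp`, make up `t ^ 2 * R`.
  have hfin : ‖φ - (Real.exp (-(t ^ 2 / 2)) : ℝ)‖ =
      Real.exp (-(t ^ 2 / 2)) * ‖φ * (Real.exp (t ^ 2 / 2) : ℝ) - 1‖ := by
    have e : φ - (Real.exp (-(t ^ 2 / 2)) : ℝ) = (Real.exp (-(t ^ 2 / 2)) : ℝ) *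
        (φ * (Real.exp (t ^ 2 / 2) : ℝ) - 1) := by
      rw [mul_sub, mul_left_comm, ← Complex.ofReal_mul, ← Real.exp_add]
      simp
    rw [e, norm_mul, Complex.norm_real, Real.norm_of_nonneg (Real.exp_pos _).le]
  have hexp : Real.exp (-(t ^ 2 / 2)) * Real.exp (t ^ 2 / 2) = 1 := by
    rw [← Real.exp_add]; simp
  have tri : ‖φ * (Real.exp (t ^ 2 / 2) : ℝ) - 1‖ ≤ Real.exp (t ^ 2 / 2) *
      (2 * |t| ^ 3 * (ε * (1 + R) + ε⁻¹ * Q) + t ^ 2 / 2 * R + t ^ 4 / 8 * Q + t ^ 2 / 2 * R) := by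
    calc _ ≤ ‖φ * (Real.exp (t ^ 2 / 2) : ℝ) - ∫ x, compensatedExp F δ t n x ∂P‖ +
          ‖∫ x, compensatedExp F δ t n x ∂P - 1‖ := norm_sub_le_norm_sub_add_norm_sub _ _ _
      _ ≤ Real.exp (t ^ 2 / 2) * (t ^ 2 / 2 * R) + Real.exp (t ^ 2 / 2) *
          (2 * |t| ^ 3 * (ε * ∫ x, V x ∂P + ε⁻¹ * Q) +
          t ^ 2 / 2 * (∫ x, V x ∂P - ∫ x, min (V x) 1 ∂P) + t ^ 4 / 8 * Q) := by
        rw [norm_sub_rev]; exact add_le_add cmp tel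
      _ ≤ Real.exp (t ^ 2 / 2) * (t ^ 2 / 2 * R) + Real.exp (t ^ 2 / 2) *
          (2 * |t| ^ 3 * (ε * (1 + R) + ε⁻¹ * Q) + t ^ 2 / 2 * R + t ^ 4 / 8 * Q) := by gcongr
      _ = _ := by ring
  rw [hfin]
  calc _ ≤ Real.exp (-(t ^ 2 / 2)) * (Real.exp (t ^ 2 / 2) *
      (2 * |t| ^ 3 * (ε * (1 + R) + ε⁻¹ * Q) + t ^ 2 / 2 * R + t ^ 4 / 8 * Q + t ^ 2 / 2 * R)) := by
        gcongr
    _ = _ := by rw [← mul_assoc, hexp]; ring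

end IsMartingaleDiff

end MartingaleCLT

/-! ### Moments of linear and quadratic forms in an i.i.d. sample -/

section SecondMoments

lemma integral_sq_sum_of_orthogonal {α κ : Type*} [MeasurableSpace α] {μ : Measure α}
    {f : κ → α → ℝ} (s : Finset κ) (hf : ∀ i ∈ s, MemLp (f i) 2 μ)
    (h0 : ∀ i ∈ s, ∀ j ∈ s, i ≠ j → ∫ x, f i x * f j x ∂μ = 0) :
    ∫ x, (∑ i ∈ s, f i x) ^ 2 ∂μ = ∑ i ∈ s, ∫ x, f i x ^ 2 ∂μ := by
  have hi : ∀ i ∈ s, ∀ j ∈ s, Integrable (fun x => f i x * f j x) μ :=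
    fun i hi j hj => (hf i hi).integrable_mul (hf j hj)
  simp only [sq, Finset.sum_mul_sum]
  rw [integral_finsetSum _ fun i h => integrable_finsetSum _ fun j h' => hi i h j h']
  refine Finset.sum_congr rfl fun i h => ?_
  rw [integral_finsetSum _ fun j h' => hi i h j h', Finset.sum_eq_single_of_mem i h]
  exact fun j hj hij => h0 i h j hj hij.symm

variable {ι E : Type*} [Fintype ι] [LinearOrder ι] [MeasurableSpace E] {F : Measure E}
  [IsProbabilityMeasure F]

lemma integral_sq_sum_eval {u : E → ℝ} (hu : MemLp u 2 F) (h0 : ∫ z, u z ∂F = 0) (c : ι → ℝ) :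
    ∫ x, (∑ i, c i * u (x i)) ^ 2 ∂sampleLaw ι F = (∑ i, c i ^ 2) * ∫ z, u z ^ 2 ∂F := by
  have hm : ∀ i, MemLp (fun x : ι → E => u (x i)) 2 (sampleLaw ι F) := fun i =>
    hu.comp_measurePreserving (measurePreserving_eval (fun _ : ι => F) i)
  rw [integral_sq_sum_of_orthogonal _ fun i _ => (hm i).const_mul (c i), Finset.sum_mul]
  · refine Finset.sum_congr rfl fun i _ => ?_
    simp only [mul_pow]
    rw [integral_const_mul]
    congr 1
    have h := (measurePreserving_eval (fun _ : ι => F) i)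
    rw [← integral_map (f := fun z => u z ^ 2) h.measurable.aemeasurable]
    · rw [h.map_eq]
    · rw [h.map_eq]; exact hu.1.pow 2
  · intro i _ j _ hij
    refine integral_eq_zero_of_resample j (((hm i).const_mul _).integrable_mul
      ((hm j).const_mul _)) fun x => ?_
    simp only [Function.update_of_ne hij, Function.update_self]
    rw [integral_const_mul, integral_const_mul, h0]; simp

/-- Two distinct pairs have an index that belongs to only one of them: the larger of the upper
indices or, if these agree, a lower index. Integrating out that coordinate annihilates the mixed
term. -/
lemma integral_sq_pairSum {h : E → E → ℝ} (hm : MemLp (fun w : E × E => h w.1 w.2) 2 (F.prod F))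
    (hs : ∀ x y, h x y = h y x) (h0 : ∀ x, ∫ z, h x z ∂F = 0) (T : Finset (ι × ι))
    (hT : ∀ q ∈ T, q.1 < q.2) (c : ι × ι → ℝ) :
    ∫ x, (∑ q ∈ T, c q * h (x q.1) (x q.2)) ^ 2 ∂sampleLaw ι F =
      (∑ q ∈ T, c q ^ 2) * ∫ w, h w.1 w.2 ^ 2 ∂F.prod F := by
  have hmq : ∀ q ∈ T, MemLp (fun x : ι → E => h (x q.1) (x q.2)) 2 (sampleLaw ι F) := fun q hq =>
    hm.comp_measurePreserving (measurePreserving_pair (F := F) (hT q hq).ne)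
  have h0' : ∀ x, ∫ z, h z x ∂F = 0 := fun x => by simp only [hs _ x, h0]
  rw [integral_sq_sum_of_orthogonal _ fun q hq => (hmq q hq).const_mul (c q), Finset.sum_mul]
  · refine Finset.sum_congr rfl fun q hq => ?_
    simp only [mul_pow]
    rw [integral_const_mul]
    congr 1
    have hp := measurePreserving_pair (F := F) (hT q hq).ne
    rw [← integral_map (f := fun w : E × E => h w.1 w.2 ^ 2) hp.measurable.aemeasurable]
    · rw [hp.map_eq]
    · rw [hp.map_eq]; exact hm.1.pow 2
  · have key : ∀ q ∈ T, ∀ r ∈ T, q ≠ r → q.2 ≤ r.2 → ∫ x, c q * h (x q.1) (x q.2) *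
        (c r * h (x r.1) (x r.2)) ∂sampleLaw ι F = 0 := by
      intro q hq r hr hqr hle
      have hint := ((hmq q hq).const_mul (c q)).integrable_mul ((hmq r hr).const_mul (c r))
      have hq' := hT q hq
      have hr' := hT r hr
      rcases hle.lt_or_eq with hlt | heq
      · refine integral_eq_zero_of_resample r.2 hint fun x => ?_
        simp only [Function.update_of_ne hlt.ne, Function.update_of_ne (hq'.trans hlt).ne,
          Function.update_of_ne hr'.ne, Function.update_self]
        rw [integral_const_mul, integral_const_mul, h0]; simp
      · have hne : q.1 ≠ r.1 := fun e => hqr (Prod.ext e heq)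
        refine integral_eq_zero_of_resample r.1 hint fun x => ?_
        simp only [Function.update_of_ne hne, Function.update_of_ne hr'.ne', heq,
          Function.update_self]
        rw [integral_const_mul, integral_const_mul, h0']; simp
    intro q hq r hr hqr
    rcases le_total q.2 r.2 with hle | hle
    · exact key q hq r hr hqr hle
    · simp only [mul_comm (c q * _)]
      exact key r hr q hq hqr.symm hle

/-- A fourth moment bound for sums of independent centered variables. -/
lemma integral_pow_four_sum_eval_le {u : E → ℝ} (hu : MemLp u 4 F) (h0 : ∫ z, u z ∂F = 0)
    {c : ι → ℝ} {A : ℝ} (hc : ∀ i, |c i| ≤ A) (s : Finset ι) :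
    ∫ x, (∑ i ∈ s, c i * u (x i)) ^ 4 ∂sampleLaw ι F ≤
      3 * (#s : ℝ) ^ 2 * A ^ 4 * ∫ z, u z ^ 4 ∂F := by
  set m2 := ∫ z, u z ^ 2 ∂F with hm2
  set m3 := ∫ z, u z ^ 3 ∂F with hm3
  set m4 := ∫ z, u z ^ 4 ∂F with hm4
  have hS : ∀ s : Finset ι, MemLp (fun x : ι → E => ∑ i ∈ s, c i * u (x i)) 4 (sampleLaw ι F) :=
    fun s => memLp_finsetSum _ fun i _ =>
      (hu.comp_measurePreserving (measurePreserving_eval (fun _ : ι => F) i)).const_mul _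
  have u1 : Integrable u F := by simpa using hu.integrable_pow_of_le_four (k := 1) (by norm_num)
  have u2 := hu.integrable_pow_of_le_four (k := 2) (by norm_num)
  have u3 := hu.integrable_pow_of_le_four (k := 3) (by norm_num)
  have u4 := hu.integrable_pow_of_le_four (k := 4) (by norm_num)
  have hc2 : ∀ i, c i ^ 2 ≤ A ^ 2 := fun i => sq_le_sq' (abs_le.1 (hc i)).1 (abs_le.1 (hc i)).2
  have hm2' : m2 ^ 2 ≤ m4 := sq_integral_sq_le hu
  have hm20 : 0 ≤ m2 := integral_nonneg fun _ => sq_nonneg _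
  -- The induction carries the first two moments as well: in the expansion of the fourth power, the
  -- zero mean removes the term with `m3`, and the second moment bounds the term with `m2`.
  suffices H : ∫ x, (∑ i ∈ s, c i * u (x i)) ∂sampleLaw ι F = 0 ∧
      ∫ x, (∑ i ∈ s, c i * u (x i)) ^ 2 ∂sampleLaw ι F ≤ #s * A ^ 2 * m2 ∧
      ∫ x, (∑ i ∈ s, c i * u (x i)) ^ 4 ∂sampleLaw ι F ≤ 3 * (#s : ℝ) ^ 2 * A ^ 4 * m4 from H.2.2
  induction s using Finset.induction_on with
  | empty => simp
  | insert j s hj ih =>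
    obtain ⟨ih1, ih2, ih4⟩ := ih
    set S := fun x : ι → E => ∑ i ∈ s, c i * u (x i) with hSdef
    have i1 : Integrable S (sampleLaw ι F) := by
      simpa using (hS s).integrable_pow_of_le_four (k := 1) (by norm_num)
    have i2 : Integrable (fun x => S x ^ 2) (sampleLaw ι F) :=
      (hS s).integrable_pow_of_le_four (k := 2) (by norm_num)
    have i4 : Integrable (fun x => S x ^ 4) (sampleLaw ι F) :=
      (hS s).integrable_pow_of_le_four (k := 4) (by norm_num)
    have hup : ∀ x z, ∑ i ∈ insert j s, c i * u (Function.update x j z i) = S x + c j * u z := by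
      intro x z
      rw [Finset.sum_insert hj, Function.update_self, add_comm]
      congr 1
      refine Finset.sum_congr rfl fun i hi => ?_
      rw [Function.update_of_ne]
      rintro rfl; exact hj hi
    have j1 : Integrable (fun x : ι → E => ∑ i ∈ insert j s, c i * u (x i)) (sampleLaw ι F) := by
      simpa using (hS (insert j s)).integrable_pow_of_le_four (k := 1) (by norm_num)
    have e2 : ∀ x, ∫ z, (S x + c j * u z) ^ 2 ∂F = S x ^ 2 + c j ^ 2 * m2 := by
      intro x
      have : ∀ z, (S x + c j * u z) ^ 2 = S x ^ 2 + 2 * S x * c j * u z + c j ^ 2 * u z ^ 2 :=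
        fun z => by ring
      simp only [this]
      have k1 : Integrable (fun z => S x ^ 2 + 2 * S x * c j * u z) F :=
        (integrable_const _).add (u1.const_mul _)
      rw [integral_add k1 (u2.const_mul _),
        integral_add (integrable_const _) (u1.const_mul _), integral_const_mul,
        integral_const_mul, h0]
      simp [hm2]
    have e4 : ∀ x, ∫ z, (S x + c j * u z) ^ 4 ∂F = S x ^ 4 + 6 * c j ^ 2 * m2 * S x ^ 2 +
        4 * c j ^ 3 * m3 * S x + c j ^ 4 * m4 := by
      intro x
      have : ∀ z, (S x + c j * u z) ^ 4 = S x ^ 4 + 4 * S x ^ 3 * c j * u z +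
          6 * S x ^ 2 * c j ^ 2 * u z ^ 2 + 4 * S x * c j ^ 3 * u z ^ 3 + c j ^ 4 * u z ^ 4 :=
        fun z => by ring
      simp only [this]
      have k1 : Integrable (fun z => S x ^ 4 + 4 * S x ^ 3 * c j * u z) F :=
        (integrable_const _).add (u1.const_mul _)
      have k2 : Integrable (fun z => S x ^ 4 + 4 * S x ^ 3 * c j * u z +
        6 * S x ^ 2 * c j ^ 2 * u z ^ 2) F := k1.add (u2.const_mul _)
      have k3 : Integrable (fun z => S x ^ 4 + 4 * S x ^ 3 * c j * u z +
        6 * S x ^ 2 * c j ^ 2 * u z ^ 2 + 4 * S x * c j ^ 3 * u z ^ 3) F :=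
        k2.add (u3.const_mul _)
      rw [integral_add k3 (u4.const_mul _), integral_add k2 (u3.const_mul _),
        integral_add k1 (u2.const_mul _), integral_add (integrable_const _) (u1.const_mul _),
        integral_const_mul, integral_const_mul, integral_const_mul, integral_const_mul, h0]
      simp only [integral_const, probReal_univ, smul_eq_mul]
      ring
    have card : ((#(insert j s) : ℕ) : ℝ) = #s + 1 := by
      rw [Finset.card_insert_of_notMem hj]; push_cast; ring
    refine ⟨?_, ?_, ?_⟩
    · rw [integral_resample j j1]
      have : ∀ x, ∫ z, (S x + c j * u z) ∂F = S x := fun x => by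
        rw [integral_add (integrable_const _) (u1.const_mul _), integral_const_mul, h0]; simp
      simp only [hup, this]
      exact ih1
    · rw [integral_resample j ((hS (insert j s)).integrable_pow_of_le_four (k := 2) (by norm_num))]
      simp only [hup, e2]
      rw [integral_add i2 (integrable_const _), card]
      simp only [integral_const, probReal_univ, smul_eq_mul, one_mul]
      nlinarith [mul_le_mul_of_nonneg_right (hc2 j) hm20]
    · rw [integral_resample j ((hS (insert j s)).integrable_pow_of_le_four (k := 4) le_rfl)]
      simp only [hup, e4]
      have k1 : Integrable (fun x => S x ^ 4 + 6 * c j ^ 2 * m2 * S x ^ 2) (sampleLaw ι F) :=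
        i4.add (i2.const_mul _)
      have k2 : Integrable (fun x => S x ^ 4 + 6 * c j ^ 2 * m2 * S x ^ 2 +
        4 * c j ^ 3 * m3 * S x) (sampleLaw ι F) := k1.add (i1.const_mul _)
      rw [integral_add k2 (integrable_const _), integral_add k1 (i1.const_mul _),
        integral_add i4 (i2.const_mul _), integral_const_mul, integral_const_mul, ih1, card]
      simp only [integral_const, probReal_univ, smul_eq_mul, one_mul, mul_zero, add_zero]
      have hm40 : 0 ≤ m4 := (sq_nonneg _).trans hm2'
      have hc4 : c j ^ 4 ≤ A ^ 4 := by
        have := mul_le_mul (hc2 j) (hc2 j) (sq_nonneg _) (sq_nonneg _)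
        nlinarith
      have b1 : 6 * c j ^ 2 * m2 * ∫ x, S x ^ 2 ∂sampleLaw ι F ≤ 6 * #s * A ^ 4 * m4 := by
        calc 6 * c j ^ 2 * m2 * ∫ x, S x ^ 2 ∂sampleLaw ι F
            ≤ 6 * A ^ 2 * m2 * (#s * A ^ 2 * m2) :=
              mul_le_mul (mul_le_mul_of_nonneg_right (mul_le_mul_of_nonneg_left (hc2 j)
                (by norm_num)) hm20) ih2 (integral_nonneg fun _ => sq_nonneg _) (by positivity)
          _ = 6 * #s * A ^ 4 * m2 ^ 2 := by ring
          _ ≤ _ := by gcongr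
      have b2 : c j ^ 4 * m4 ≤ A ^ 4 * m4 := by gcongr
      have b3 : 0 ≤ A ^ 4 * m4 := by positivity
      have b4 : ∫ x, S x ^ 4 ∂sampleLaw ι F ≤ 3 * (#s : ℝ) ^ 2 * A ^ 4 * m4 := ih4
      -- With $s$ terms so far, the total is at most $(3s^2+6s+1)A^4m_4\le 3(s+1)^2A^4m_4$.
      nlinarith

end SecondMoments

/-! ### Degenerate kernels and their Gram kernels -/

section Degenerate

variable {E : Type*} [MeasurableSpace E]

/-- A symmetric kernel with finite fourth moments that is degenerate with respect to `F`. -/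
structure IsDegenerateKernel (F : Measure E) (h : E → E → ℝ) : Prop where
  measurable : Measurable fun w : E × E => h w.1 w.2
  symm : ∀ x y, h x y = h y x
  centered : ∀ x, ∫ z, h x z ∂F = 0
  memLp : MemLp (fun w : E × E => h w.1 w.2) 4 (F.prod F)
  memLp_right : ∀ x, MemLp (h x) 4 F

/-- The kernel `E h(x, Z) h(y, Z)` with `Z` of law `F`. -/
def gramKernel (F : Measure E) (h : E → E → ℝ) (x y : E) : ℝ := ∫ z, h x z * h y z ∂F

/-- The increments of the weighted `U`-statistic `∑ i < k, a i k * h (x i) (x k)`. -/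
def kernelDiff {n : ℕ} (a : Fin n → Fin n → ℝ) (h : E → E → ℝ) (k : Fin n) (x : Fin n → E)
    (z : E) : ℝ := ∑ i ∈ Finset.Iio k, a i k * h (x i) z

lemma gramKernel_symm (F : Measure E) (h : E → E → ℝ) (x y : E) : gramKernel F h x y = gramKernel F h y x := by
  simp only [gramKernel, mul_comm]

lemma gramKernel_self (F : Measure E) (h : E → E → ℝ) (x : E) : gramKernel F h x x = ∫ z, h x z ^ 2 ∂F := by
  simp only [gramKernel, sq]

variable {F : Measure E} [IsProbabilityMeasure F] {h : E → E → ℝ}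

namespace IsDegenerateKernel

variable (hh : IsDegenerateKernel F h)
include hh

lemma isMartingaleDiff_kernelDiff {n : ℕ} (a : Fin n → Fin n → ℝ) :
    IsMartingaleDiff F (kernelDiff a h) where
  measurable k := Finset.measurable_fun_sum _ fun i _ =>
    (hh.measurable.comp (measurePreserving_eval_prod (F := F) i).measurable).const_mul _
  memLp k := memLp_finsetSum _ fun i _ =>
    (hh.memLp.comp_measurePreserving (measurePreserving_eval_prod (F := F) i)).const_mul _
  memLp_right k x := memLp_finsetSum _ fun i _ => (hh.memLp_right (x i)).const_mul _
  centered k x := by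
    simp only [kernelDiff]
    rw [integral_finsetSum]
    · simp [integral_const_mul, hh.centered]
    · exact fun i _ => (((hh.memLp_right (x i)).integrable (by norm_num)).const_mul _)
  adapted j k hkj x z := by
    ext w
    refine Finset.sum_congr rfl fun i hi => ?_
    rw [Function.update_of_ne]
    exact ((Finset.mem_Iio.1 hi).trans_le hkj).ne

lemma measurable_gramKernel : Measurable fun w : E × E => gramKernel F h w.1 w.2 := by
  have h1 : StronglyMeasurable fun q : (E × E) × E => h q.1.1 q.2 * h q.1.2 q.2 := by
    refine Measurable.stronglyMeasurable (Measurable.mul ?_ ?_)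
    · exact hh.measurable.comp
        ((measurable_fst.comp measurable_fst).prodMk measurable_snd)
    · exact hh.measurable.comp
        ((measurable_snd.comp measurable_fst).prodMk measurable_snd)
  exact h1.integral_prod_right'.measurable

lemma integrable_mul (x y : E) : Integrable (fun z => h x z * h y z) F :=
  (hh.memLp_right x).two_of_four.integrable_mul (hh.memLp_right y).two_of_four

/-- Cauchy-Schwarz, from the discriminant of the nonnegative quadratic polynomial $s\mapsto\mathbb
E(s\,h(x,Z)+h(y,Z))^2$. -/
lemma gramKernel_sq_le (x y : E) :
    gramKernel F h x y ^ 2 ≤ (∫ z, h x z ^ 2 ∂F) * ∫ z, h y z ^ 2 ∂F := by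
  have hx := (hh.memLp_right x).integrable_pow_of_le_four (k := 2) (by norm_num)
  have hy := (hh.memLp_right y).integrable_pow_of_le_four (k := 2) (by norm_num)
  have hxy := hh.integrable_mul x y
  have key : ∀ s : ℝ, 0 ≤ (∫ z, h x z ^ 2 ∂F) * (s * s) + (2 * gramKernel F h x y) * s +
      ∫ z, h y z ^ 2 ∂F := by
    intro s
    have e : ∫ z, (s * h x z + h y z) ^ 2 ∂F = (∫ z, h x z ^ 2 ∂F) * (s * s) +
        (2 * gramKernel F h x y) * s + ∫ z, h y z ^ 2 ∂F := by
      have : ∀ z, (s * h x z + h y z) ^ 2 =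
        (s * s) * h x z ^ 2 + (2 * s) * (h x z * h y z) + h y z ^ 2 := fun z => by ring
      simp only [this]
      have k1 : Integrable (fun z => (s * s) * h x z ^ 2 + (2 * s) * (h x z * h y z)) F :=
        (hx.const_mul _).add (hxy.const_mul _)
      rw [integral_add k1 hy, integral_add (hx.const_mul _) (hxy.const_mul _),
        integral_const_mul, integral_const_mul, gramKernel]
      ring
    rw [← e]
    exact integral_nonneg fun _ => sq_nonneg _
  have := discrim_le_zero key
  rw [discrim] at this
  nlinarith

lemma memLp_rowMoment : MemLp (fun x => ∫ z, h x z ^ 2 ∂F) 2 F := by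
  have hm : StronglyMeasurable fun w : E × E => h w.1 w.2 ^ 2 :=
    (hh.measurable.pow_const 2).stronglyMeasurable
  have hm' := hm.integral_prod_right' (ν := F)
  refine (memLp_two_iff_integrable_sq hm'.aestronglyMeasurable).2 ?_
  have i4 : Integrable (fun x => ∫ z, h x z ^ 4 ∂F) F :=
    (hh.memLp.integrable_pow_of_le_four le_rfl).integral_prod_left
  refine i4.mono' (hm'.aestronglyMeasurable.pow 2) (ae_of_all _ fun x => ?_)
  rw [Real.norm_of_nonneg (sq_nonneg _)]
  exact sq_integral_sq_le (hh.memLp_right x)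

lemma integral_rowMoment : ∫ x, ∫ z, h x z ^ 2 ∂F ∂F = ∫ w, h w.1 w.2 ^ 2 ∂F.prod F :=
  (integral_prod _ (hh.memLp.integrable_pow_of_le_four (k := 2) (by norm_num))).symm

lemma integral_rowMoment_sq_le :
    ∫ x, (∫ z, h x z ^ 2 ∂F) ^ 2 ∂F ≤ ∫ w, h w.1 w.2 ^ 4 ∂F.prod F := by
  have i4 := hh.memLp.integrable_pow_of_le_four (k := 4) le_rfl
  rw [integral_prod _ i4]
  exact integral_mono hh.memLp_rowMoment.integrable_sq i4.integral_prod_left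
    fun x => sq_integral_sq_le (hh.memLp_right x)

lemma memLp_gramKernel : MemLp (fun w : E × E => gramKernel F h w.1 w.2) 2 (F.prod F) := by
  refine (memLp_two_iff_integrable_sq hh.measurable_gramKernel.aestronglyMeasurable).2 ?_
  have hi : Integrable (fun x => ∫ z, h x z ^ 2 ∂F) F := hh.memLp_rowMoment.integrable (by norm_num)
  refine (hi.mul_prod hi).mono'
    (hh.measurable_gramKernel.pow_const 2).aestronglyMeasurable (ae_of_all _ fun w => ?_)
  rw [Real.norm_of_nonneg (sq_nonneg _)]
  exact hh.gramKernel_sq_le w.1 w.2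

/-- The Gram kernel inherits degeneracy, so `integral_sq_pairSum` applies to the off-diagonal part
of the conditional variance too. -/
lemma integral_gramKernel (x : E) : ∫ y, gramKernel F h x y ∂F = 0 := by
  simp only [gramKernel]
  rw [integral_integral_swap]
  · have h0 : ∀ z, ∫ y, h x z * h y z ∂F = 0 := fun z => by
      rw [integral_const_mul]
      simp only [hh.symm _ z, hh.centered, mul_zero]
    simp [h0]
  · have h1 : MemLp (fun w : E × E => h x w.2) 2 (F.prod F) :=
      ((hh.memLp_right x).two_of_four).comp_measurePreserving measurePreserving_snd
    exact h1.integrable_mul hh.memLp.two_of_four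

end IsDegenerateKernel

end Degenerate

/-! ### Normal approximation of weighted degenerate U-statistics -/

section Degenerate

lemma sum_prod_eq_diag_add_two_mul {ι : Type*} [Fintype ι] [LinearOrder ι] {f : ι × ι → ℝ}
    (hf : ∀ q, f q.swap = f q) :
    ∑ q, f q = ∑ i, f (i, i) + 2 * ∑ q with q.1 < q.2, f q := by
  have h1 : ∀ q : ι × ι, f q = (if q.1 < q.2 then f q else 0) + (if q.2 < q.1 then f q else 0) +
      (if q.1 = q.2 then f q else 0) := by
    intro q
    rcases lt_trichotomy q.1 q.2 with h | h | h
    · simp [h, h.ne, h.not_gt]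
    · simp [h]
    · simp [h, h.ne', h.not_gt]
  have h2 : ∑ q : ι × ι, (if q.2 < q.1 then f q else 0) =
      ∑ q : ι × ι, (if q.1 < q.2 then f q else 0) := by
    rw [← (Equiv.prodComm ι ι).sum_comp]
    refine Finset.sum_congr rfl fun q _ => ?_
    simp only [Equiv.prodComm_apply, hf, Prod.fst_swap, Prod.snd_swap]
  have h3 : ∑ q : ι × ι, (if q.1 = q.2 then f q else 0) = ∑ i, f (i, i) := by
    rw [Fintype.sum_prod_type]
    simp
  rw [Finset.sum_congr rfl fun q _ => h1 q, Finset.sum_add_distrib, Finset.sum_add_distrib, h2, h3,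
    Finset.sum_filter]
  ring

variable {E : Type*} [MeasurableSpace E] {F : Measure E} [IsProbabilityMeasure F] {h : E → E → ℝ}
  {n : ℕ}

/-- The coefficients of the conditional variance of a weighted `U`-statistic. -/
def gramCoeff (a : Fin n → Fin n → ℝ) (q : Fin n × Fin n) : ℝ :=
  ∑ k, if q.1 < k ∧ q.2 < k then a q.1 k * a q.2 k else 0

lemma gramCoeff_swap (a : Fin n → Fin n → ℝ) (q : Fin n × Fin n) :
    gramCoeff a q.swap = gramCoeff a q := by
  simp only [gramCoeff, Prod.fst_swap, Prod.snd_swap, and_comm, mul_comm]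

lemma gramCoeff_sq_le {a : Fin n → Fin n → ℝ} {A : ℝ} (ha : ∀ i k, |a i k| ≤ A)
    (q : Fin n × Fin n) : gramCoeff a q ^ 2 ≤ n ^ 2 * A ^ 4 := by
  have h1 : |gramCoeff a q| ≤ n * A ^ 2 := by
    refine (Finset.abs_sum_le_sum_abs _ _).trans ?_
    have : ∀ k ∈ (Finset.univ : Finset (Fin n)),
        |if q.1 < k ∧ q.2 < k then a q.1 k * a q.2 k else 0| ≤ A ^ 2 := by
      intro k _
      split_ifs
      · rw [abs_mul, sq]
        exact mul_le_mul (ha _ _) (ha _ _) (abs_nonneg _) ((abs_nonneg _).trans (ha q.1 k))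
      · simpa using sq_nonneg A
    simpa using Finset.sum_le_card_nsmul _ _ _ this
  calc gramCoeff a q ^ 2 ≤ (n * A ^ 2) ^ 2 := sq_le_sq' (abs_le.1 h1).1 (abs_le.1 h1).2
    _ = _ := by ring

lemma sum_gramCoeff_diag (a : Fin n → Fin n → ℝ) :
    ∑ i, gramCoeff a (i, i) = ∑ k, ∑ i ∈ Finset.Iio k, a i k ^ 2 := by
  simp only [gramCoeff]
  rw [Finset.sum_comm]
  refine Finset.sum_congr rfl fun k _ => ?_
  rw [← Finset.sum_filter]
  refine Finset.sum_congr (by ext; simp) fun i _ => by ring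

namespace IsDegenerateKernel

variable (hh : IsDegenerateKernel F h)
include hh

lemma sum_condMoment_two (a : Fin n → Fin n → ℝ) (x : Fin n → E) :
    ∑ k, condMoment F (kernelDiff a h) 2 k x =
      ∑ q : Fin n × Fin n, gramCoeff a q * gramKernel F h (x q.1) (x q.2) := by
  have h1 : ∀ k, condMoment F (kernelDiff a h) 2 k x =
      ∑ q : Fin n × Fin n, (if q.1 < k ∧ q.2 < k then a q.1 k * a q.2 k else 0) *
        gramKernel F h (x q.1) (x q.2) := by
    intro k
    have h2 : ∀ z, kernelDiff a h k x z ^ 2 = ∑ q ∈ Finset.Iio k ×ˢ Finset.Iio k,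
        a q.1 k * a q.2 k * (h (x q.1) z * h (x q.2) z) := by
      intro z
      rw [kernelDiff, sq, Finset.sum_mul_sum, ← Finset.sum_product']
      exact Finset.sum_congr rfl fun q _ => by ring
    simp only [condMoment, h2]
    rw [integral_finsetSum _ fun q _ => (hh.integrable_mul _ _).const_mul _]
    simp only [integral_const_mul, ite_mul, zero_mul]
    rw [← Finset.sum_filter]
    exact Finset.sum_congr (by ext; simp) fun q _ => rfl
  simp only [h1, gramCoeff, Finset.sum_mul]
  exact Finset.sum_comm

/-- The fluctuation of the conditional variance. -/
lemma integral_sq_sum_condMoment_sub_le {a : Fin n → Fin n → ℝ} {A : ℝ}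
    (ha : ∀ i k, |a i k| ≤ A)
    (hnorm : (∑ k, ∑ i ∈ Finset.Iio k, a i k ^ 2) * ∫ w, h w.1 w.2 ^ 2 ∂F.prod F = 1) :
    Integrable (fun x => (∑ k, condMoment F (kernelDiff a h) 2 k x - 1) ^ 2)
      (sampleLaw (Fin n) F) ∧
    ∫ x, (∑ k, condMoment F (kernelDiff a h) 2 k x - 1) ^ 2 ∂sampleLaw (Fin n) F ≤
      2 * (n ^ 3 * A ^ 4 * ∫ w, h w.1 w.2 ^ 4 ∂F.prod F) +
      8 * (n ^ 4 * A ^ 4 * ∫ w, gramKernel F h w.1 w.2 ^ 2 ∂F.prod F) := by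
  set P := sampleLaw (Fin n) F
  set τ := ∫ w, h w.1 w.2 ^ 2 ∂F.prod F with hτ
  set u : E → ℝ := fun x => ∫ z, h x z ^ 2 ∂F - τ with hu
  set T : Finset (Fin n × Fin n) := Finset.univ.filter fun q => q.1 < q.2 with hT
  have hTlt : ∀ q ∈ T, q.1 < q.2 := fun q hq => (Finset.mem_filter.1 hq).2
  have hm2 := hh.memLp_rowMoment
  have hu2 : MemLp u 2 F := hm2.sub (memLp_const τ)
  have hm1 : Integrable (fun x => ∫ z, h x z ^ 2 ∂F) F := hm2.integrable (by norm_num)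
  have hu0 : ∫ z, u z ∂F = 0 := by
    rw [hu, integral_sub hm1 (integrable_const _), hh.integral_rowMoment]
    simp [hτ]
  have hu4 : ∫ z, u z ^ 2 ∂F ≤ ∫ w, h w.1 w.2 ^ 4 ∂F.prod F := by
    refine le_trans ?_ hh.integral_rowMoment_sq_le
    have e : ∀ z, u z ^ 2 = (∫ w, h z w ^ 2 ∂F) ^ 2 - 2 * τ * (∫ w, h z w ^ 2 ∂F) + τ ^ 2 :=
      fun z => by rw [hu]; ring
    simp only [e]
    have k1 : Integrable (fun z => (∫ w, h z w ^ 2 ∂F) ^ 2 - 2 * τ * (∫ w, h z w ^ 2 ∂F)) F :=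
      hm2.integrable_sq.sub (hm1.const_mul _)
    rw [integral_add k1 (integrable_const _), integral_sub hm2.integrable_sq (hm1.const_mul _),
      integral_const_mul, hh.integral_rowMoment]
    simp only [integral_const, probReal_univ, smul_eq_mul, one_mul]
    nlinarith [sq_nonneg τ]
  -- By `hnorm` the diagonal has mean exactly 1. The fluctuation is thus a sum of independent
  -- centered terms plus a degenerate U-statistic with the Gram kernel.
  have dec : ∀ x, ∑ k, condMoment F (kernelDiff a h) 2 k x - 1 =
      ∑ i, gramCoeff a (i, i) * u (x i) +
        2 * ∑ q ∈ T, gramCoeff a q * gramKernel F h (x q.1) (x q.2) := by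
    intro x
    rw [hh.sum_condMoment_two, sum_prod_eq_diag_add_two_mul]
    · simp only [hu, mul_sub, Finset.sum_sub_distrib]
      rw [← Finset.sum_mul, sum_gramCoeff_diag, hnorm]
      simp only [gramKernel_self]
      ring
    · intro q
      rw [gramCoeff_swap, Prod.fst_swap, Prod.snd_swap, gramKernel_symm]
  have hD : MemLp (fun x : Fin n → E => ∑ i, gramCoeff a (i, i) * u (x i)) 2 P :=
    memLp_finsetSum _ fun i _ =>
      (hu2.comp_measurePreserving (measurePreserving_eval (fun _ : Fin n => F) i)).const_mul _
  have hU : MemLp (fun x : Fin n → E => ∑ q ∈ T, gramCoeff a q * gramKernel F h (x q.1) (x q.2))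
      2 P :=
    memLp_finsetSum _ fun q hq => (hh.memLp_gramKernel.comp_measurePreserving
      (measurePreserving_pair (F := F) (hTlt q hq).ne)).const_mul _
  have hDU : Integrable (fun x => (∑ k, condMoment F (kernelDiff a h) 2 k x - 1) ^ 2) P := by
    simp only [dec]
    exact (hD.add (hU.const_mul 2)).integrable_sq
  refine ⟨hDU, ?_⟩
  have b0 : ∫ x, (∑ k, condMoment F (kernelDiff a h) 2 k x - 1) ^ 2 ∂P ≤
      ∫ x, (2 * (∑ i, gramCoeff a (i, i) * u (x i)) ^ 2 +
        8 * (∑ q ∈ T, gramCoeff a q * gramKernel F h (x q.1) (x q.2)) ^ 2) ∂P := by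
    refine integral_mono hDU ((hD.integrable_sq.const_mul _).add (hU.integrable_sq.const_mul _))
      fun x => ?_
    simp only [dec]
    nlinarith [sq_nonneg (∑ i, gramCoeff a (i, i) * u (x i) -
      2 * ∑ q ∈ T, gramCoeff a q * gramKernel F h (x q.1) (x q.2))]
  refine b0.trans ?_
  rw [integral_add (hD.integrable_sq.const_mul _) (hU.integrable_sq.const_mul _),
    integral_const_mul, integral_const_mul, integral_sq_sum_eval hu2 hu0,
    integral_sq_pairSum hh.memLp_gramKernel (gramKernel_symm F h) hh.integral_gramKernel T hTlt]
  -- Each squared coefficient is at most $n^2A^4$. There are $n$ diagonal ones, and at most $n^2$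
  -- off the diagonal.
  have c1 : ∑ i, gramCoeff a (i, i) ^ 2 ≤ (n : ℝ) ^ 3 * A ^ 4 := by
    have := Finset.sum_le_card_nsmul Finset.univ (fun i => gramCoeff a (i, i) ^ 2) _
      fun i _ => gramCoeff_sq_le ha (i, i)
    refine this.trans (le_of_eq ?_)
    rw [Finset.card_univ, Fintype.card_fin, nsmul_eq_mul]; ring
  have c2 : ∑ q ∈ T, gramCoeff a q ^ 2 ≤ (n : ℝ) ^ 4 * A ^ 4 := by
    have := Finset.sum_le_card_nsmul T (fun q => gramCoeff a q ^ 2) _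
      fun q _ => gramCoeff_sq_le ha q
    refine this.trans ?_
    have hc : (#T : ℝ) ≤ n ^ 2 := by
      have : #T ≤ #(Finset.univ : Finset (Fin n × Fin n)) := Finset.card_le_card (by simp)
      rw [Finset.card_univ, Fintype.card_prod, Fintype.card_fin] at this
      calc (#T : ℝ) ≤ ((n * n : ℕ) : ℝ) := by exact_mod_cast this
        _ = _ := by push_cast; ring
    rw [nsmul_eq_mul]
    calc (#T : ℝ) * (n ^ 2 * A ^ 4) ≤ n ^ 2 * (n ^ 2 * A ^ 4) := by
          gcongr
      _ = _ := by ring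
  have p1 : 0 ≤ ∫ z, u z ^ 2 ∂F := integral_nonneg fun _ => sq_nonneg _
  have p2 : 0 ≤ ∫ w, gramKernel F h w.1 w.2 ^ 2 ∂F.prod F := integral_nonneg fun _ => sq_nonneg _
  have p3 : 0 ≤ (n : ℝ) ^ 3 * A ^ 4 := by positivity
  have f1 := mul_le_mul c1 hu4 p1 p3
  have f2 := mul_le_mul_of_nonneg_right c2 p2
  linarith

/-- For a fixed new point `z`, the increment is a sum of at most $n$ independent centered terms, so
its fourth moment is of order $n^2$ rather than $n^4$. Summation over `k` gives $n^3$. -/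
lemma sum_integral_condMoment_four_le {a : Fin n → Fin n → ℝ} {A : ℝ} (ha : ∀ i k, |a i k| ≤ A) :
    ∑ k, ∫ x, condMoment F (kernelDiff a h) 4 k x ∂sampleLaw (Fin n) F ≤
      3 * (n ^ 3 * A ^ 4 * ∫ w, h w.1 w.2 ^ 4 ∂F.prod F) := by
  have i4 := hh.memLp.integrable_pow_of_le_four (k := 4) le_rfl
  have h1 : ∀ k : Fin n, ∫ x, condMoment F (kernelDiff a h) 4 k x ∂sampleLaw (Fin n) F ≤
      3 * n ^ 2 * A ^ 4 * ∫ w, h w.1 w.2 ^ 4 ∂F.prod F := by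
    intro k
    have j4 := ((hh.isMartingaleDiff_kernelDiff a).memLp k).integrable_pow_of_le_four
      (k := 4) le_rfl
    simp only [condMoment]
    rw [integral_integral_swap j4, integral_prod_symm _ i4, ← integral_const_mul]
    refine integral_mono j4.integral_prod_right (i4.integral_prod_right.const_mul _) fun z => ?_
    have hz := integral_pow_four_sum_eval_le (ι := Fin n) (hh.memLp_right z) (hh.centered z)
      (c := fun i => a i k) (fun i => ha i k) (Finset.Iio k)
    simp only [hh.symm _ z, kernelDiff]
    refine hz.trans ?_
    have p : 0 ≤ ∫ w, h z w ^ 4 ∂F := integral_nonneg fun _ => by positivity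
    have hc : (#(Finset.Iio k) : ℝ) ≤ n := by
      rw [Fin.card_Iio]; exact_mod_cast k.2.le
    gcongr
  refine (Finset.sum_le_card_nsmul _ _ _ fun k _ => h1 k).trans (le_of_eq ?_)
  rw [Finset.card_univ, Fintype.card_fin, nsmul_eq_mul]; ring

/-- The characteristic function of a normalized weighted degenerate `U`-statistic. -/
theorem norm_charFun_sub_gaussian_le {a : Fin n → Fin n → ℝ} {A : ℝ} (ha : ∀ i k, |a i k| ≤ A)
    (hnorm : (∑ k, ∑ i ∈ Finset.Iio k, a i k ^ 2) * ∫ w, h w.1 w.2 ^ 2 ∂F.prod F = 1)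
    (t : ℝ) {ε B : ℝ} (hε : 0 < ε)
    (hB4 : n ^ 3 * A ^ 4 * ∫ w, h w.1 w.2 ^ 4 ∂F.prod F ≤ B)
    (hBg : n ^ 4 * A ^ 4 * ∫ w, gramKernel F h w.1 w.2 ^ 2 ∂F.prod F ≤ B) :
    ‖∫ x, Complex.exp ((t * ∑ k, ∑ i ∈ Finset.Iio k, a i k * h (x i) (x k) : ℝ) * Complex.I)
        ∂sampleLaw (Fin n) F - (Real.exp (-(t ^ 2 / 2)) : ℝ)‖ ≤
      2 * |t| ^ 3 * ε + (2 * |t| ^ 3 * ε + t ^ 2) * (ε + ε⁻¹ * (10 * B)) +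
        (2 * |t| ^ 3 * ε⁻¹ + t ^ 4 / 8) * (3 * B) := by
  have hδ := hh.isMartingaleDiff_kernelDiff a
  refine (hδ.norm_integral_exp_sub_gaussian_le t hε).trans ?_
  obtain ⟨hi, hb⟩ := hh.integral_sq_sum_condMoment_sub_le ha hnorm
  have hQ := hh.sum_integral_condMoment_four_le ha
  have hiV : Integrable (fun x => |∑ k, condMoment F (kernelDiff a h) 2 k x - 1|)
      (sampleLaw (Fin n) F) :=
    ((integrable_finsetSum _ fun k _ => hδ.integrable_condMoment (by norm_num) k).sub
      (integrable_const _)).abs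
  -- The inequality $y\le\varepsilon+\varepsilon^{-1}y^2$ passes from mean square to mean;
  -- $10B=2B+8B$ comes from the two parts of the variance bound.
  have hR : ∫ x, |∑ k, condMoment F (kernelDiff a h) 2 k x - 1| ∂sampleLaw (Fin n) F ≤
      ε + ε⁻¹ * (10 * B) := by
    calc _ ≤ ∫ x, (ε + ε⁻¹ * (∑ k, condMoment F (kernelDiff a h) 2 k x - 1) ^ 2)
          ∂sampleLaw (Fin n) F := by
          refine integral_mono hiV ((integrable_const _).add (hi.const_mul _)) fun x => ?_
          simp only
          rw [← sq_abs]
          set y := |∑ k, condMoment F (kernelDiff a h) 2 k x - 1|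
          have hy : 0 ≤ y := abs_nonneg _
          have e : ε + ε⁻¹ * y ^ 2 - y = ε⁻¹ * ((ε - y) ^ 2 + ε * y) := by field_simp; ring
          have : 0 ≤ ε⁻¹ * ((ε - y) ^ 2 + ε * y) := by positivity
          linarith
      _ = ε + ε⁻¹ * ∫ x, (∑ k, condMoment F (kernelDiff a h) 2 k x - 1) ^ 2
          ∂sampleLaw (Fin n) F := by
          rw [integral_add (integrable_const _) (hi.const_mul _), integral_const_mul]; simp
      _ ≤ _ := by gcongr; linarith
  gcongr
  linarith

end IsDegenerateKernel

end Degenerate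

/-! ### The four-cycle moment -/

section Cycle

variable {E : Type*} [MeasurableSpace E] {F : Measure E} [IsProbabilityMeasure F] {h : E → E → ℝ}

lemma memLp_two_mul_of_four {α : Type*} [MeasurableSpace α] {μ : Measure α} {f g : α → ℝ}
    [IsFiniteMeasure μ] (hf : MemLp f 4 μ) (hg : MemLp g 4 μ) :
    MemLp (fun x => f x * g x) 2 μ := by
  refine (memLp_two_iff_integrable_sq (hf.1.mul hg.1)).2 ?_
  refine ((hf.integrable_pow_of_le_four le_rfl).add (hg.integrable_pow_of_le_four le_rfl)).mono'
    ((hf.1.mul hg.1).pow 2) (ae_of_all _ fun x => ?_)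
  rw [Real.norm_of_nonneg (sq_nonneg _)]
  simp only [Pi.add_apply, Pi.mul_apply]
  nlinarith [sq_nonneg (f x ^ 2 - g x ^ 2), sq_nonneg (f x ^ 2), sq_nonneg (g x ^ 2)]

/-- Given coordinates 0 and 1, the coordinates 3 and 2 can be integrated out in turn, each leaving
one factor `gramKernel F h (w 0) (w 1)`. -/
lemma IsDegenerateKernel.integral_cycle (hh : IsDegenerateKernel F h) :
    ∫ w : Fin 4 → E, h (w 0) (w 2) * h (w 1) (w 2) * h (w 0) (w 3) * h (w 1) (w 3)
      ∂(sampleLaw (Fin 4) F) = ∫ w, gramKernel F h w.1 w.2 ^ 2 ∂F.prod F := by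
  have hL : ∀ {i j : Fin 4}, i ≠ j →
      MemLp (fun w : Fin 4 → E => h (w i) (w j)) 4 (sampleLaw (Fin 4) F) := fun hij =>
    hh.memLp.comp_measurePreserving (measurePreserving_pair (F := F) hij)
  have hg : MemLp (fun w : Fin 4 → E => gramKernel F h (w 0) (w 1)) 2 (sampleLaw (Fin 4) F) :=
    hh.memLp_gramKernel.comp_measurePreserving
      (measurePreserving_pair (F := F) (by decide : (0 : Fin 4) ≠ 1))
  have h2 := memLp_two_mul_of_four (hL (by decide : (0 : Fin 4) ≠ 2))
    (hL (by decide : (1 : Fin 4) ≠ 2))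
  have h3 := memLp_two_mul_of_four (hL (by decide : (0 : Fin 4) ≠ 3))
    (hL (by decide : (1 : Fin 4) ≠ 3))
  have i3 : Integrable (fun w : Fin 4 → E =>
      h (w 0) (w 2) * h (w 1) (w 2) * h (w 0) (w 3) * h (w 1) (w 3)) (sampleLaw (Fin 4) F) := by
    have := h2.integrable_mul h3
    refine this.congr (ae_of_all _ fun w => ?_)
    simp only [Pi.mul_apply]; ring
  have i2 : Integrable (fun w : Fin 4 → E =>
      h (w 0) (w 2) * h (w 1) (w 2) * gramKernel F h (w 0) (w 1)) (sampleLaw (Fin 4) F) :=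
    h2.integrable_mul hg
  rw [integral_resample 3 i3]
  have e3 : ∀ x : Fin 4 → E, ∫ z, h (Function.update x 3 z 0) (Function.update x 3 z 2) *
      h (Function.update x 3 z 1) (Function.update x 3 z 2) *
      h (Function.update x 3 z 0) (Function.update x 3 z 3) *
      h (Function.update x 3 z 1) (Function.update x 3 z 3) ∂F =
      h (x 0) (x 2) * h (x 1) (x 2) * gramKernel F h (x 0) (x 1) := by
    intro x
    rw [gramKernel, ← integral_const_mul]
    refine integral_congr_ae (ae_of_all _ fun z => ?_)
    simp [Function.update]
    ring
  simp only [e3]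
  rw [integral_resample 2 i2]
  have e2 : ∀ x : Fin 4 → E, ∫ z, h (Function.update x 2 z 0) (Function.update x 2 z 2) *
      h (Function.update x 2 z 1) (Function.update x 2 z 2) *
      gramKernel F h (Function.update x 2 z 0) (Function.update x 2 z 1) ∂F =
      gramKernel F h (x 0) (x 1) ^ 2 := by
    intro x
    have e : gramKernel F h (x 0) (x 1) ^ 2 =
        ∫ z, gramKernel F h (x 0) (x 1) * (h (x 0) z * h (x 1) z) ∂F := by
      rw [integral_const_mul, sq, gramKernel]
    rw [e]
    refine integral_congr_ae (ae_of_all _ fun z => ?_)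
    simp [Function.update]
    ring
  simp only [e2]
  have hp := measurePreserving_pair (F := F) (by decide : (0 : Fin 4) ≠ 1)
  rw [← integral_map (f := fun w : E × E => gramKernel F h w.1 w.2 ^ 2) hp.measurable.aemeasurable]
  · rw [hp.map_eq]
  · rw [hp.map_eq]; exact hh.memLp_gramKernel.1.pow 2

end Cycle

/-! ### The double-centered distance as a degenerate kernel -/

section DoubleCentered

variable {p : ℕ} {F : Measure (EuclideanSpace ℝ (Fin p))} [IsProbabilityMeasure F]

lemma dcDist_eq_sub_add (F : Measure (EuclideanSpace ℝ (Fin p)))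
    (x y : EuclideanSpace ℝ (Fin p)) :
    dcDist F x y = ‖x - y‖ - (∫ z, ‖x - z‖ ∂F) - (∫ z, ‖y - z‖ ∂F) +
      ∫ w, ‖w.1 - w.2‖ ∂(F.prod F) := by
  simp only [dcDist, norm_sub_rev _ y]

/-- The double-centered distance is a degenerate kernel. -/
lemma isDegenerateKernel_dcDist (hF : Integrable (fun x => ‖x‖ ^ 4) F) :
    IsDegenerateKernel F (dcDist F) := by
  have hid : MemLp (fun x : EuclideanSpace ℝ (Fin p) => x) 4 F := by
    have h1 : MemLp (fun x : EuclideanSpace ℝ (Fin p) => ‖x‖) 4 F :=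
      (memLp_four_iff continuous_norm.aestronglyMeasurable).2 hF
    exact (memLp_norm_iff (by fun_prop)).1 h1
  have hdist : MemLp (fun w : EuclideanSpace ℝ (Fin p) × EuclideanSpace ℝ (Fin p) =>
      ‖w.1 - w.2‖) 4 (F.prod F) :=
    ((hid.comp_measurePreserving measurePreserving_fst).sub
      (hid.comp_measurePreserving measurePreserving_snd)).norm
  have hrow : ∀ x, MemLp (fun z : EuclideanSpace ℝ (Fin p) => ‖x - z‖) 4 F := fun x =>
    ((memLp_const x).sub hid).norm
  have hmφ : Measurable fun x : EuclideanSpace ℝ (Fin p) => ∫ z, ‖x - z‖ ∂F := by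
    have : StronglyMeasurable fun w : EuclideanSpace ℝ (Fin p) × EuclideanSpace ℝ (Fin p) =>
        ‖w.1 - w.2‖ :=
      Measurable.stronglyMeasurable (by fun_prop)
    exact this.integral_prod_right'.measurable
  have hφ : MemLp (fun x : EuclideanSpace ℝ (Fin p) => ∫ z, ‖x - z‖ ∂F) 4 F := by
    refine MemLp.mono (g := fun x => ‖x‖ + ∫ z, ‖z‖ ∂F) (hid.norm.add (memLp_const _))
      hmφ.aestronglyMeasurable (ae_of_all _ fun x => ?_)
    have h1 : Integrable (fun z : EuclideanSpace ℝ (Fin p) => ‖z‖) F :=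
      (hid.integrable (by norm_num)).norm
    have h0 : 0 ≤ ∫ z, ‖z‖ ∂F := integral_nonneg fun _ => norm_nonneg _
    rw [Real.norm_of_nonneg (integral_nonneg fun _ => norm_nonneg _),
      Real.norm_of_nonneg (by positivity)]
    calc ∫ z, ‖x - z‖ ∂F ≤ ∫ z, (‖x‖ + ‖z‖) ∂F :=
          integral_mono ((hrow x).integrable (by norm_num)) ((integrable_const _).add h1)
            fun z => norm_sub_le _ _
      _ = _ := by rw [integral_add (integrable_const _) h1]; simp
  refine ⟨?_, ?_, ?_, ?_, ?_⟩
  · simp only [dcDist_eq_sub_add]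
    have h1 : Measurable fun w : EuclideanSpace ℝ (Fin p) × EuclideanSpace ℝ (Fin p) =>
        ∫ z, ‖w.1 - z‖ ∂F := hmφ.comp measurable_fst
    have h2 : Measurable fun w : EuclideanSpace ℝ (Fin p) × EuclideanSpace ℝ (Fin p) =>
        ∫ z, ‖w.2 - z‖ ∂F := hmφ.comp measurable_snd
    have h3 : Measurable fun w : EuclideanSpace ℝ (Fin p) × EuclideanSpace ℝ (Fin p) =>
        ‖w.1 - w.2‖ := by fun_prop
    exact ((h3.sub h1).sub h2).add_const _
  · intro x y
    simp only [dcDist_eq_sub_add, norm_sub_rev x y]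
    ring
  · intro x
    simp only [dcDist_eq_sub_add]
    have i1 : Integrable (fun z => ‖x - z‖) F := (hrow x).integrable (by norm_num)
    have i2 : Integrable (fun z => ∫ w, ‖z - w‖ ∂F) F := hφ.integrable (by norm_num)
    have i12 : Integrable (fun z => ‖x - z‖ - ∫ w, ‖x - w‖ ∂F) F := i1.sub (integrable_const _)
    have i13 : Integrable (fun z => ‖x - z‖ - ∫ w, ‖x - w‖ ∂F - ∫ w, ‖z - w‖ ∂F) F := i12.sub i2
    rw [integral_add i13 (integrable_const _), integral_sub i12 i2,
      integral_sub i1 (integrable_const _), integral_prod _ (hdist.integrable (by norm_num))]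
    simp
  · simp only [dcDist_eq_sub_add]
    exact ((hdist.sub (hφ.comp_measurePreserving measurePreserving_fst)).sub
      (hφ.comp_measurePreserving measurePreserving_snd)).add (memLp_const _)
  · intro x
    have : MemLp (fun z => ‖x - z‖ - (∫ z, ‖x - z‖ ∂F) - (∫ w, ‖z - w‖ ∂F) +
      ∫ w, ‖w.1 - w.2‖ ∂(F.prod F)) 4 F :=
      (((hrow x).sub (memLp_const _)).sub hφ).add (memLp_const _)
    exact (memLp_congr_ae (ae_of_all _ fun z => dcDist_eq_sub_add F x z)).2 this

lemma dcCycle_eq (hF : Integrable (fun x => ‖x‖ ^ 4) F) :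
    dcCycle F = ∫ w, gramKernel F (dcDist F) w.1 w.2 ^ 2 ∂F.prod F :=
  (isDegenerateKernel_dcDist hF).integral_cycle

end DoubleCentered

/-! ### Pair weights of the Gini covariance -/

section Weights

variable {n K : ℕ}

/-- The coefficient of `‖x i - x j‖` in the sample Gini covariance. -/
def pairWeight (y : Fin n → Fin K) (i j : Fin n) : ℝ :=
  ((n.choose 2 : ℕ) : ℝ)⁻¹ -
    if y i = y j then classProp y (y i) * (((classSize y (y i)).choose 2 : ℕ) : ℝ)⁻¹ else 0

lemma pairWeight_symm (y : Fin n → Fin K) (i j : Fin n) :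
    pairWeight y i j = pairWeight y j i := by
  unfold pairWeight
  by_cases h : y i = y j
  · simp [h]
  · simp [h, Ne.symm h]

/-- The coefficient of `E d(X₁, X₂)²` in `σ₀²`. -/
def varCoeff (y : Fin n → Fin K) : ℝ :=
  (∑ k, classProp y k ^ 2 * (((classSize y k).choose 2 : ℕ) : ℝ)⁻¹) - ((n.choose 2 : ℕ) : ℝ)⁻¹

lemma sum_Iio_eq_sum_ite {f : Fin n → Fin n → ℝ} :
    ∑ k, ∑ i ∈ Finset.Iio k, f i k = ∑ i, ∑ k, if i < k then f i k else 0 := by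
  rw [Finset.sum_comm]
  refine Finset.sum_congr rfl fun k _ => ?_
  rw [← Finset.sum_filter]
  exact Finset.sum_congr (by ext; simp) fun _ _ => rfl

lemma gCov_eq_sum_pairWeight {p : ℕ} (x : Fin n → EuclideanSpace ℝ (Fin p)) (y : Fin n → Fin K) :
    gCov x y = ∑ k, ∑ i ∈ Finset.Iio k, pairWeight y i k * ‖x i - x k‖ := by
  have h1 : ∀ S : Finset (Fin n), ∑ i ∈ S, ∑ j ∈ S with i < j, ‖x i - x j‖ =
      ∑ k, ∑ i ∈ Finset.Iio k, if i ∈ S ∧ k ∈ S then ‖x i - x k‖ else 0 := by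
    intro S
    rw [sum_Iio_eq_sum_ite, ← Finset.sum_subset (Finset.subset_univ S)]
    · refine Finset.sum_congr rfl fun i hi => ?_
      rw [Finset.sum_filter, ← Finset.sum_subset (Finset.subset_univ S)]
      · exact Finset.sum_congr rfl fun j hj => by simp [hi, hj]
      · intro j _ hj; simp [hj]
    · intro i _ hi; simp [hi]
  have h2 : ∑ l, classProp y l * gmdU x (cls y l) = ∑ k, ∑ i ∈ Finset.Iio k,
      (if y i = y k then classProp y (y i) * (((classSize y (y i)).choose 2 : ℕ) : ℝ)⁻¹ else 0) *
        ‖x i - x k‖ := by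
    simp only [gmdU, h1, Finset.mul_sum]
    rw [Finset.sum_comm]
    refine Finset.sum_congr rfl fun k _ => ?_
    rw [Finset.sum_comm]
    refine Finset.sum_congr rfl fun i _ => ?_
    rw [Finset.sum_eq_single (y i)]
    · by_cases h : y i = y k
      · simp [cls, classSize, h, mul_assoc]
      · simp [cls, h, Ne.symm h]
    · intro l _ hl; simp [cls, Ne.symm hl]
    · simp
  rw [gCov, h2, gmdU, h1, Finset.mul_sum, ← Finset.sum_sub_distrib]
  refine Finset.sum_congr rfl fun k _ => ?_
  rw [Finset.mul_sum, ← Finset.sum_sub_distrib]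
  refine Finset.sum_congr rfl fun i _ => ?_
  simp [pairWeight, sub_mul]

/-- Every pair is charged to both of its endpoints, so additive functions see only the row sums of
the weights. -/
lemma sum_Iio_mul_add {w : Fin n → Fin n → ℝ} (hw : ∀ i j, w i j = w j i) (α : Fin n → ℝ) :
    ∑ k, ∑ i ∈ Finset.Iio k, w i k * (α i + α k) =
      ∑ i, (∑ j ∈ Finset.univ.erase i, w i j) * α i := by
  have h1 : ∑ k, ∑ i ∈ Finset.Iio k, w i k * α k = ∑ i, ∑ j, if j < i then w i j * α i else 0 := by
    refine Finset.sum_congr rfl fun k _ => ?_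
    rw [← Finset.sum_filter]
    exact Finset.sum_congr (by ext; simp) fun i _ => by rw [hw]
  simp only [mul_add, Finset.sum_add_distrib]
  rw [h1, sum_Iio_eq_sum_ite, ← Finset.sum_add_distrib]
  refine Finset.sum_congr rfl fun i _ => ?_
  rw [← Finset.sum_add_distrib, Finset.sum_mul, ← Finset.add_sum_erase _ _ (Finset.mem_univ i)]
  simp only [lt_self_iff_false, if_false, add_zero, zero_add]
  refine Finset.sum_congr rfl fun j hj => ?_
  rcases lt_or_gt_of_ne (Finset.ne_of_mem_erase hj) with h | h
  · simp [h, h.not_gt]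
  · simp [h, h.not_gt]

lemma sum_comp_eq_sum_classSize (y : Fin n → Fin K) (f : Fin K → ℝ) :
    ∑ i, f (y i) = ∑ k, (classSize y k : ℝ) * f k := by
  rw [← Finset.sum_fiberwise (s := Finset.univ) (g := y)]
  refine Finset.sum_congr rfl fun k _ => ?_
  rw [Finset.sum_congr rfl (g := fun _ => f k) fun i hi => by rw [(Finset.mem_filter.1 hi).2]]
  simp [classSize, cls]

lemma sum_erase_ite (y : Fin n → Fin K) (i : Fin n) (A B : ℝ) :
    ∑ j ∈ Finset.univ.erase i, (if y i = y j then A else B) =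
      ((classSize y (y i) : ℝ) - 1) * A + ((n : ℝ) - classSize y (y i)) * B := by
  have h := Finset.add_sum_erase Finset.univ (fun j => if y i = y j then A else B)
    (Finset.mem_univ i)
  have h2 : ∑ j, (if y i = y j then A else B) =
      (classSize y (y i) : ℝ) * A + ((n : ℝ) - classSize y (y i)) * B := by
    have e : ∀ j, (if y i = y j then A else B) = (if y j = y i then A - B else 0) + B := fun j => by
      by_cases hj : y i = y j
      · simp [hj]
      · simp [hj, Ne.symm hj]
    simp only [e, Finset.sum_add_distrib]
    rw [← Finset.sum_filter, Finset.sum_const, Finset.sum_const, Finset.card_univ,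
      Fintype.card_fin, nsmul_eq_mul, nsmul_eq_mul, classSize, cls]
    ring
  simp only [if_true] at h
  linarith

lemma sum_classSize (y : Fin n → Fin K) : ∑ k, (classSize y k : ℝ) = n := by
  have := sum_comp_eq_sum_classSize y fun _ => 1
  simpa using this.symm

lemma sum_classProp (hn : n ≠ 0) (y : Fin n → Fin K) : ∑ k, classProp y k = 1 := by
  have : (n : ℝ) ≠ 0 := by exact_mod_cast hn
  simp only [classProp]
  rw [← Finset.sum_div, sum_classSize, div_self this]

/-- The cancellation $(n-1)\binom n2^{-1}=\frac2n=\hat p_k(n_k-1)\binom{n_k}2^{-1}$. The last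
equality needs $n_k\ge2$, as an inverse of zero would be zero. -/
lemma sum_pairWeight_row {y : Fin n → Fin K} (hy : ∀ k, 2 ≤ classSize y k) (i : Fin n) :
    ∑ j ∈ Finset.univ.erase i, pairWeight y i j = 0 := by
  have hk : (2 : ℝ) ≤ classSize y (y i) := by exact_mod_cast hy (y i)
  have hn : (classSize y (y i) : ℝ) ≤ n := by
    have : classSize y (y i) ≤ Fintype.card (Fin n) := Finset.card_le_univ _
    rw [Fintype.card_fin] at this
    exact_mod_cast this
  have e : ∀ j, pairWeight y i j = if y i = y j then ((n.choose 2 : ℕ) : ℝ)⁻¹ -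
      classProp y (y i) * (((classSize y (y i)).choose 2 : ℕ) : ℝ)⁻¹ else
      ((n.choose 2 : ℕ) : ℝ)⁻¹ := fun j => by
    unfold pairWeight
    split_ifs <;> simp
  simp only [e]
  rw [sum_erase_ite, Nat.cast_choose_two, Nat.cast_choose_two, classProp]
  generalize (classSize y (y i) : ℝ) = m at *
  have h1 : m - 1 ≠ 0 := by linarith
  have h2 : (n : ℝ) - 1 ≠ 0 := by linarith
  have h3 : (n : ℝ) ≠ 0 := by linarith
  have h4 : m ≠ 0 := by linarith
  field_simp
  ring

lemma sum_pairWeight_sq {y : Fin n → Fin K} (hn2 : 2 ≤ n) (hy : ∀ k, 2 ≤ classSize y k) :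
    ∑ k, ∑ i ∈ Finset.Iio k, pairWeight y i k ^ 2 = varCoeff y := by
  -- The constant function 1/2 gives `α i + α k = 1`: a sum over pairs is half the sum of all rows.
  have h0 := sum_Iio_mul_add (w := fun i j => pairWeight y i j ^ 2)
    (fun i j => by rw [pairWeight_symm]) fun _ => 1 / 2
  have hn : (2 : ℝ) ≤ n := by exact_mod_cast hn2
  have e : ∀ i j, pairWeight y i j ^ 2 = if y i = y j then (((n.choose 2 : ℕ) : ℝ)⁻¹ -
      classProp y (y i) * (((classSize y (y i)).choose 2 : ℕ) : ℝ)⁻¹) ^ 2 else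
      (((n.choose 2 : ℕ) : ℝ)⁻¹) ^ 2 := fun i j => by
    unfold pairWeight
    split_ifs <;> simp
  norm_num only at h0
  simp only [mul_one] at h0
  rw [h0]
  simp only [e, sum_erase_ite]
  rw [sum_comp_eq_sum_classSize y (fun k => (((classSize y k : ℝ) - 1) * (((n.choose 2 : ℕ) : ℝ)⁻¹ -
      classProp y k * (((classSize y k).choose 2 : ℕ) : ℝ)⁻¹) ^ 2 +
      ((n : ℝ) - classSize y k) * (((n.choose 2 : ℕ) : ℝ)⁻¹) ^ 2) * (1 / 2))]
  have h1 : ((n.choose 2 : ℕ) : ℝ)⁻¹ = ∑ k, classProp y k * ((n.choose 2 : ℕ) : ℝ)⁻¹ := by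
    rw [← Finset.sum_mul, sum_classProp (by omega), one_mul]
  rw [varCoeff]
  -- The third occurrence is the term subtracted in `varCoeff`. Once it is split in the proportions
  -- `classProp y k`, the identity holds class by class.
  nth_rewrite 3 [h1]
  rw [← Finset.sum_sub_distrib]
  refine Finset.sum_congr rfl fun k _ => ?_
  have hk : (2 : ℝ) ≤ classSize y k := by exact_mod_cast hy k
  rw [Nat.cast_choose_two, Nat.cast_choose_two, classProp]
  generalize (classSize y k : ℝ) = m at *
  have h1 : m - 1 ≠ 0 := by linarith
  have h2 : (n : ℝ) - 1 ≠ 0 := by linarith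
  have h3 : (n : ℝ) ≠ 0 := by linarith
  have h4 : m ≠ 0 := by linarith
  field_simp
  ring

/-- The Gini covariance is a weighted degenerate `U`-statistic. -/
lemma gCov_eq_sum_dcDist {p : ℕ} (F : Measure (EuclideanSpace ℝ (Fin p)))
    (x : Fin n → EuclideanSpace ℝ (Fin p)) {y : Fin n → Fin K} (hy : ∀ k, 2 ≤ classSize y k) :
    gCov x y = ∑ k, ∑ i ∈ Finset.Iio k, pairWeight y i k * dcDist F (x i) (x k) := by
  -- Half of the constant goes to each point, so that `‖x i - x k‖ - dcDist F (x i) (x k) = α i + α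
  -- k`.
  set α : Fin n → ℝ := fun i => (∫ z, ‖x i - z‖ ∂F) - (∫ w, ‖w.1 - w.2‖ ∂(F.prod F)) / 2
  have h0 := sum_Iio_mul_add (pairWeight_symm y) α
  simp only [sum_pairWeight_row hy, zero_mul, Finset.sum_const_zero] at h0
  rw [gCov_eq_sum_pairWeight, ← sub_eq_zero, ← h0, ← Finset.sum_sub_distrib]
  refine Finset.sum_congr rfl fun k _ => ?_
  rw [← Finset.sum_sub_distrib]
  refine Finset.sum_congr rfl fun i _ => ?_
  rw [dcDist_eq_sub_add]
  simp only [α]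
  ring

variable {c : ℝ} {y : Fin n → Fin K}

lemma two_le_classSize (hc : ∀ k, c ≤ classProp y k) (hcn : 2 ≤ c * n) (k : Fin K) :
    2 ≤ classSize y k := by
  have hn : (0 : ℝ) < n := by
    rcases (Nat.cast_nonneg n : (0 : ℝ) ≤ n).eq_or_lt with h | h
    · rw [← h] at hcn; norm_num at hcn
    · exact h
  have := hc k
  rw [classProp, le_div_iff₀ hn] at this
  have h2 : (2 : ℝ) ≤ classSize y k := hcn.trans this
  exact_mod_cast h2

/-- A class of proportion $q$ contributes $q\cdot\frac{2(1-q)}{(qn-1)(n-1)}$, and a second class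
keeps $1-q\ge c$. With a single class the coefficient would vanish. -/
lemma varCoeff_ge (hK : 2 ≤ K) (hc0 : 0 < c) (hc : ∀ k, c ≤ classProp y k) (hcn : 2 ≤ c * n) :
    2 * c / n ^ 2 ≤ varCoeff y := by
  have hy := two_le_classSize hc hcn
  have hn : (0 : ℝ) < n := by
    rcases (Nat.cast_nonneg n : (0 : ℝ) ≤ n).eq_or_lt with h | h
    · rw [← h] at hcn; norm_num at hcn
    · exact h
  have hn0 : n ≠ 0 := by rintro rfl; simp at hn
  have h1 : ((n.choose 2 : ℕ) : ℝ)⁻¹ = ∑ k, classProp y k * ((n.choose 2 : ℕ) : ℝ)⁻¹ := by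
    rw [← Finset.sum_mul, sum_classProp hn0, one_mul]
  have h2 : 2 * c / (n : ℝ) ^ 2 = ∑ k, classProp y k * (2 * c / n ^ 2) := by
    rw [← Finset.sum_mul, sum_classProp hn0, one_mul]
  rw [varCoeff, h1, h2, ← Finset.sum_sub_distrib]
  refine Finset.sum_le_sum fun k _ => ?_
  -- another class
  obtain ⟨l, hl⟩ : ∃ l : Fin K, l ≠ k := by
    have : Nontrivial (Fin K) := Fin.nontrivial_iff_two_le.2 hK
    exact exists_ne k
  have hlk : classProp y k + classProp y l ≤ 1 := by
    rw [← sum_classProp hn0 y, ← Finset.sum_pair hl.symm]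
    exact Finset.sum_le_sum_of_subset_of_nonneg (Finset.subset_univ _) fun j _ _ =>
      hc0.le.trans (hc j)
  have hkc : classProp y k ≤ 1 - c := by linarith [hc l]
  have hk : (2 : ℝ) ≤ classSize y k := by exact_mod_cast hy k
  have hck : c ≤ classProp y k := hc k
  have hm : (classSize y k : ℝ) = classProp y k * n := by rw [classProp]; field_simp
  rw [Nat.cast_choose_two, Nat.cast_choose_two, hm]
  rw [hm] at hk
  generalize classProp y k = q at *
  have hq : 0 < q := hc0.trans_le hck
  have hq1 : 0 < 1 - q := by linarith
  have hn2 : (2 : ℝ) ≤ n := by nlinarith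
  have hqn : 0 < q * n - 1 := by linarith
  have hn1 : 0 < (n : ℝ) - 1 := by linarith
  have e : q ^ 2 * (q * n * (q * n - 1) / 2)⁻¹ - q * ((n : ℝ) * (n - 1) / 2)⁻¹ =
      q * (2 * (1 - q) / ((q * n - 1) * (n - 1))) := by
    field_simp
    ring
  rw [e]
  refine mul_le_mul_of_nonneg_left ?_ hq.le
  rw [div_le_div_iff₀ (by positivity) (by positivity)]
  have h5 : (q * n - 1) * (n - 1) ≤ (n : ℝ) ^ 2 := by nlinarith
  have h6 : 0 ≤ (q * n - 1) * ((n : ℝ) - 1) := by positivity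
  calc 2 * c * ((q * n - 1) * (n - 1)) ≤ 2 * c * (n : ℝ) ^ 2 := by gcongr
    _ ≤ 2 * (1 - q) * (n : ℝ) ^ 2 := by gcongr; linarith

/-- The two parts of a weight are both nonnegative and both within the bound, hence so is their
difference in absolute value. The factor 4 absorbs $n-1\ge n/2$ and $n_k-1\ge n_k/2$. -/
lemma abs_pairWeight_le (hc0 : 0 < c) (hc : ∀ k, c ≤ classProp y k) (hcn : 2 ≤ c * n)
    (i j : Fin n) : |pairWeight y i j| ≤ 4 / (c * n ^ 2) := by
  have hn : (0 : ℝ) < n := by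
    rcases (Nat.cast_nonneg n : (0 : ℝ) ≤ n).eq_or_lt with h | h
    · rw [← h] at hcn; norm_num at hcn
    · exact h
  have hq1 : classProp y (y i) ≤ 1 := by
    rw [classProp, div_le_one hn]
    have : classSize y (y i) ≤ Fintype.card (Fin n) := Finset.card_le_univ _
    rw [Fintype.card_fin] at this
    exact_mod_cast this
  have hck : c ≤ classProp y (y i) := hc (y i)
  have hm : (classSize y (y i) : ℝ) = classProp y (y i) * n := by rw [classProp]; field_simp
  have hk : (2 : ℝ) ≤ classSize y (y i) := by exact_mod_cast two_le_classSize hc hcn (y i)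
  unfold pairWeight
  rw [Nat.cast_choose_two, Nat.cast_choose_two, hm]
  rw [hm] at hk
  generalize classProp y (y i) = q at *
  have hq : 0 < q := hc0.trans_le hck
  have hn2 : (2 : ℝ) ≤ n := by nlinarith
  have hqn : 0 < q * n - 1 := by linarith
  have hn1 : 0 < (n : ℝ) - 1 := by linarith
  have b1 : ((n : ℝ) * (n - 1) / 2)⁻¹ ≤ 4 / (c * n ^ 2) := by
    rw [inv_eq_one_div, div_le_div_iff₀ (by positivity) (by positivity)]
    have : c * (n : ℝ) ^ 2 ≤ 1 * (n : ℝ) ^ 2 := by gcongr; linarith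
    nlinarith
  have b2 : q * (q * n * (q * n - 1) / 2)⁻¹ ≤ 4 / (c * n ^ 2) := by
    have e : q * (q * n * (q * n - 1) / 2)⁻¹ = 2 / (n * (q * n - 1)) := by field_simp
    rw [e, div_le_div_iff₀ (by positivity) (by positivity)]
    have : c * (n : ℝ) ≤ q * n := by gcongr
    nlinarith
  have p1 : 0 ≤ ((n : ℝ) * (n - 1) / 2)⁻¹ := by positivity
  have p2 : 0 ≤ q * (q * n * (q * n - 1) / 2)⁻¹ := by positivity
  have p3 : 0 ≤ 4 / (c * (n : ℝ) ^ 2) := by positivity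
  rw [abs_le]
  split_ifs <;> constructor <;> linarith

end Weights

/-! ### Variance and normal approximation for fixed labels -/

section FixedLabels

variable {p n K : ℕ} {F : Measure (EuclideanSpace ℝ (Fin p))} [IsProbabilityMeasure F]
  {y : Fin n → Fin K}

lemma sum_Iio_eq_sum_filter (f : Fin n → Fin n → ℝ) :
    ∑ k, ∑ i ∈ Finset.Iio k, f i k = ∑ q : Fin n × Fin n with q.1 < q.2, f q.1 q.2 := by
  rw [sum_Iio_eq_sum_ite, Finset.sum_filter, Fintype.sum_prod_type]

lemma sigmaSq_eq (F : Measure (EuclideanSpace ℝ (Fin p))) (y : Fin n → Fin K) :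
    sigmaSq F y = varCoeff y * dcMoment F 2 := rfl

lemma two_le_of_two_le_classSize (hK : 2 ≤ K) (hy : ∀ k, 2 ≤ classSize y k) : 2 ≤ n := by
  have : classSize y ⟨0, by omega⟩ ≤ Fintype.card (Fin n) := Finset.card_le_univ _
  rw [Fintype.card_fin] at this
  exact (hy _).trans this

/-- The variance of the Gini covariance of a sample with nonrandom labels. -/
lemma variance_gCov (hF : Integrable (fun x => ‖x‖ ^ 4) F) (hK : 2 ≤ K)
    (hy : ∀ k, 2 ≤ classSize y k) :
    Var[fun x => gCov x y; sampleLaw (Fin n) F] = sigmaSq F y := by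
  have hh := isDegenerateKernel_dcDist hF
  have hm2 := hh.memLp.two_of_four
  set T : Finset (Fin n × Fin n) := Finset.univ.filter fun q => q.1 < q.2 with hT
  have hTlt : ∀ q ∈ T, q.1 < q.2 := fun q hq => (Finset.mem_filter.1 hq).2
  have e : (fun x : Fin n → EuclideanSpace ℝ (Fin p) => gCov x y) =
      fun x => ∑ q ∈ T, pairWeight y q.1 q.2 * dcDist F (x q.1) (x q.2) := by
    ext x
    rw [gCov_eq_sum_dcDist F x hy, sum_Iio_eq_sum_filter]
  have hmq : ∀ q ∈ T, MemLp (fun x : Fin n → EuclideanSpace ℝ (Fin p) =>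
      pairWeight y q.1 q.2 * dcDist F (x q.1) (x q.2)) 2 (sampleLaw (Fin n) F) := fun q hq =>
    (hm2.comp_measurePreserving (measurePreserving_pair (F := F) (hTlt q hq).ne)).const_mul _
  have hmean : ∫ x : Fin n → EuclideanSpace ℝ (Fin p),
      ∑ q ∈ T, pairWeight y q.1 q.2 * dcDist F (x q.1) (x q.2) ∂sampleLaw (Fin n) F = 0 := by
    rw [integral_finsetSum _ fun q hq => (hmq q hq).integrable (by norm_num)]
    refine Finset.sum_eq_zero fun q hq => ?_
    refine integral_eq_zero_of_resample q.2 ((hmq q hq).integrable (by norm_num)) fun x => ?_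
    simp only [Function.update_of_ne (hTlt q hq).ne, Function.update_self]
    rw [integral_const_mul, hh.centered, mul_zero]
  rw [e, variance_of_integral_eq_zero (memLp_finsetSum _ hmq).1.aemeasurable hmean,
    integral_sq_pairSum hm2 hh.symm hh.centered T hTlt (fun q => pairWeight y q.1 q.2),
    ← sum_Iio_eq_sum_filter (fun i k => pairWeight y i k ^ 2),
    sum_pairWeight_sq (two_le_of_two_le_classSize hK hy) hy, sigmaSq_eq, dcMoment]

/-- The error in the normal approximation of the Gini covariance. -/
def normalApproxError (t ε B : ℝ) : ℝ :=
  2 * |t| ^ 3 * ε + (2 * |t| ^ 3 * ε + t ^ 2) * (ε + ε⁻¹ * (10 * B)) +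
    (2 * |t| ^ 3 * ε⁻¹ + t ^ 4 / 8) * (3 * B)

/-- The error depends on the labels through the lower bound `c` only, which is what permits
averaging over random labels. -/
lemma norm_charFun_gCov_sub_le (hF : Integrable (fun x => ‖x‖ ^ 4) F) (hpos : 0 < dcMoment F 2)
    (hK : 2 ≤ K) {c : ℝ} (hc0 : 0 < c) (hc : ∀ k, c ≤ classProp y k) (hcn : 2 ≤ c * n)
    (t : ℝ) {ε B : ℝ} (hε : 0 < ε)
    (hB4 : 64 / c ^ 6 * (dcMoment F 4 / (n * dcMoment F 2 ^ 2)) ≤ B)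
    (hBg : 64 / c ^ 6 * (dcCycle F / dcMoment F 2 ^ 2) ≤ B) :
    ‖∫ x, Complex.exp ((t * (gCov x y / √(sigmaSq F y)) : ℝ) * Complex.I) ∂sampleLaw (Fin n) F -
        (Real.exp (-(t ^ 2 / 2)) : ℝ)‖ ≤ normalApproxError t ε B := by
  have hh := isDegenerateKernel_dcDist hF
  have hy := two_le_classSize hc hcn
  have hn : (0 : ℝ) < n := by
    have := two_le_of_two_le_classSize hK hy
    exact_mod_cast (by omega : 0 < n)
  have hs := varCoeff_ge hK hc0 hc hcn
  have hs0 : 0 < varCoeff y := lt_of_lt_of_le (by positivity) hs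
  set τ := dcMoment F 2 with hτ
  have hσ : 0 < sigmaSq F y := by rw [sigmaSq_eq]; positivity
  have hσ' : 2 * c * τ / n ^ 2 ≤ sigmaSq F y := by
    rw [sigmaSq_eq, mul_div_right_comm]; gcongr
  -- The quotient of the weight bound $4/(cn^2)$ by the lower bound $\sqrt{2c\tau}/n$ for
  -- $\sigma_0$.
  set A : ℝ := √(8 / (c ^ 3 * n ^ 2 * τ)) with hA
  have hA4 : A ^ 4 = 64 / (c ^ 6 * n ^ 4 * τ ^ 2) := by
    rw [show A ^ 4 = (A ^ 2) ^ 2 by ring, hA, Real.sq_sqrt (by positivity)]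
    field_simp
    norm_num
  have ha : ∀ i k, |pairWeight y i k / √(sigmaSq F y)| ≤ A := by
    intro i k
    refine Real.abs_le_sqrt ?_
    rw [div_pow, Real.sq_sqrt hσ.le, div_le_iff₀ hσ, ← sq_abs]
    calc |pairWeight y i k| ^ 2 ≤ (4 / (c * n ^ 2)) ^ 2 := by
          gcongr; exact abs_pairWeight_le hc0 hc hcn i k
      _ = 8 / (c ^ 3 * n ^ 2 * τ) * (2 * c * τ / n ^ 2) := by field_simp; norm_num
      _ ≤ _ := by gcongr
  have hnorm : (∑ k, ∑ i ∈ Finset.Iio k, (pairWeight y i k / √(sigmaSq F y)) ^ 2) *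
      ∫ w, dcDist F w.1 w.2 ^ 2 ∂F.prod F = 1 := by
    simp only [div_pow, Real.sq_sqrt hσ.le]
    simp only [← Finset.sum_div]
    rw [sum_pairWeight_sq (two_le_of_two_le_classSize hK hy) hy, sigmaSq_eq]
    change varCoeff y / (varCoeff y * τ) * τ = 1
    field_simp
  have key := hh.norm_charFun_sub_gaussian_le (a := fun i k => pairWeight y i k / √(sigmaSq F y))
    ha hnorm t hε (B := B) ?_ ?_
  · have e : ∀ x : Fin n → EuclideanSpace ℝ (Fin p), gCov x y / √(sigmaSq F y) =
        ∑ k, ∑ i ∈ Finset.Iio k, pairWeight y i k / √(sigmaSq F y) * dcDist F (x i) (x k) := by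
      intro x
      rw [gCov_eq_sum_dcDist F x hy]
      simp only [Finset.sum_div, div_mul_eq_mul_div]
    simp only [e]
    exact key
  · rw [hA4]
    refine le_trans (le_of_eq ?_) hB4
    change n ^ 3 * (64 / (c ^ 6 * n ^ 4 * τ ^ 2)) * dcMoment F 4 = _
    field_simp
  · rw [hA4, ← dcCycle_eq hF]
    refine le_trans (le_of_eq ?_) hBg
    field_simp

lemma measurable_gCov (y : Fin n → Fin K) :
    Measurable fun x : Fin n → EuclideanSpace ℝ (Fin p) => gCov x y := by
  simp only [gCov_eq_sum_pairWeight]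
  fun_prop

lemma measurable_gCov_div (F : Measure (EuclideanSpace ℝ (Fin p))) :
    Measurable fun w : (Fin n → EuclideanSpace ℝ (Fin p)) × (Fin n → Fin K) =>
      gCov w.1 w.2 / √(sigmaSq F w.2) :=
  measurable_from_prod_countable_left fun y => (measurable_gCov y).div_const (√(sigmaSq F y))

end FixedLabels

/-! ### Conditioning on an independent variable -/

section Mixture

variable {Ω α β : Type*} [MeasurableSpace Ω] [MeasurableSpace α] [MeasurableSpace β]
  {μ : Measure Ω} [IsProbabilityMeasure μ]

/-- Expectations of bounded functions of independent variables, by conditioning on the second. -/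
lemma norm_integral_indep_sub_le {X : Ω → α} {Y : Ω → β} (hX : Measurable X) (hY : Measurable Y)
    (hXY : IndepFun X Y μ) {g : α × β → ℂ} (hg : Measurable g) (hg1 : ∀ w, ‖g w‖ ≤ 1) {L : ℂ}
    (hL : ‖L‖ ≤ 1) {G : Set β} (hG : MeasurableSet G) {b : ℝ} (hb0 : 0 ≤ b)
    (hb : ∀ y ∈ G, ‖∫ x, g (x, y) ∂μ.map X - L‖ ≤ b) :
    ‖∫ ω, g (X ω, Y ω) ∂μ - L‖ ≤ b + 2 * (1 - μ.real (Y ⁻¹' G)) := by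
  have : IsProbabilityMeasure (μ.map X) := Measure.isProbabilityMeasure_map hX.aemeasurable
  have : IsProbabilityMeasure (μ.map Y) := Measure.isProbabilityMeasure_map hY.aemeasurable
  have hgi : Integrable g ((μ.map X).prod (μ.map Y)) :=
    .of_bound hg.aestronglyMeasurable 1 (ae_of_all _ hg1)
  have hlaw := (indepFun_iff_map_prod_eq_prod_map_map hX.aemeasurable hY.aemeasurable).1 hXY
  rw [← integral_map (f := g) (hX.prodMk hY).aemeasurable hg.aestronglyMeasurable, hlaw,
    integral_prod_symm _ hgi]
  have e : ∫ y, ∫ x, g (x, y) ∂μ.map X ∂μ.map Y - L =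
      ∫ y, (∫ x, g (x, y) ∂μ.map X - L) ∂μ.map Y := by
    rw [integral_sub hgi.integral_prod_right (integrable_const _)]; simp
  rw [e]
  have hind : Integrable (fun y => Gᶜ.indicator (fun _ => (2 : ℝ)) y) (μ.map Y) :=
    (integrable_const _).indicator hG.compl
  -- Outside `G` two quantities of norm at most 1 are compared, at distance at most 2.
  refine (norm_integral_le_of_norm_le (g := fun y => b + Gᶜ.indicator (fun _ => (2 : ℝ)) y)
    ((integrable_const _).add hind) (ae_of_all _ fun y => ?_)).trans (le_of_eq ?_)
  · by_cases hy : y ∈ G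
    · simpa [hy] using hb y hy
    · have h1 : ‖∫ x, g (x, y) ∂μ.map X‖ ≤ 1 := by
        simpa using norm_integral_le_of_norm_le_const (μ := μ.map X)
          (ae_of_all _ fun x => hg1 (x, y))
      rw [Set.indicator_of_mem (by simpa using hy)]
      linarith [norm_sub_le (∫ x, g (x, y) ∂μ.map X) L]
  · rw [integral_add (integrable_const _) hind, integral_indicator hG.compl]
    have h2 : (μ.map Y).real Gᶜ = 1 - μ.real (Y ⁻¹' G) := by
      rw [probReal_compl_eq_one_sub hG, map_measureReal_apply hY hG]
    simp [h2, mul_comm]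

lemma map_cond_eq_of_indepFun {X : Ω → α} {Y : Ω → β} (hX : Measurable X) (hY : Measurable Y)
    (hXY : IndepFun X Y μ) {s : Set β} (hs : MeasurableSet s) (h0 : μ (Y ⁻¹' s) ≠ 0) :
    (μ[|Y ⁻¹' s]).map X = μ.map X := by
  ext t ht
  rw [Measure.map_apply hX ht, Measure.map_apply hX ht, cond_apply (hY hs), Set.inter_comm,
    hXY.measure_inter_preimage_eq_mul _ _ ht hs, mul_comm, mul_assoc,
    ENNReal.mul_inv_cancel h0 (measure_ne_top _ _), mul_one]

end Mixture

/-! ### Class sizes and class proportions -/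

section Labels

variable {K : ℕ}

lemma classSize_eq_sum_indicator {n : ℕ} {Ω : Type*} (Y : Fin n → Ω → Fin K) (k : Fin K) (ω : Ω) :
    (classSize (fun i => Y i ω) k : ℝ) =
      ∑ i, ({ω | Y i ω = k} : Set Ω).indicator (fun _ => (1 : ℝ)) ω := by
  simp [classSize, cls, Set.indicator_apply]

/-- Chebyshev's inequality for the class sizes of independent labels. -/
lemma measureReal_classProp_lt_le {n : ℕ} (hn : 0 < n) {Ω : Type*} [MeasurableSpace Ω]
    {μ : Measure Ω} [IsProbabilityMeasure μ] {Y : Fin n → Ω → Fin K}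
    (hY : ∀ i, Measurable (Y i)) (hind : iIndepFun Y μ) {k : Fin K} {q : ℝ} (hq : 0 < q)
    (hlaw : ∀ i, μ.real {ω | Y i ω = k} = q) :
    μ.real {ω | classProp (fun i => Y i ω) k < q / 2} ≤ 4 / (n * q ^ 2) := by
  set Z : Fin n → Ω → ℝ := fun i => ({ω | Y i ω = k} : Set Ω).indicator fun _ => (1 : ℝ) with hZ
  have hms : ∀ i, MeasurableSet {ω | Y i ω = k} := fun i => hY i (measurableSet_singleton k)
  have hZm : ∀ i, Measurable (Z i) := fun i => measurable_const.indicator (hms i)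
  have hZL : ∀ i, MemLp (Z i) 2 μ := fun i => (memLp_const (1 : ℝ)).indicator (hms i)
  have hZE : ∀ i, μ[Z i] = q := fun i => by
    rw [hZ, integral_indicator_const _ (hms i), hlaw]; simp
  have hZind : iIndepFun Z μ := by
    have := hind.comp (fun _ (l : Fin K) => if l = k then (1 : ℝ) else 0)
      fun _ => measurable_of_countable _
    convert this using 1
    ext i ω
    simp [hZ, Set.indicator_apply]
  have hvar1 : ∀ i, Var[Z i; μ] ≤ 1 := fun i => by
    refine (variance_le_expectation_sq (hZm i).aestronglyMeasurable).trans ?_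
    have : ∀ ω, (Z i ^ 2) ω ≤ 1 := fun ω => by
      simp only [hZ, Pi.pow_apply, Set.indicator_apply]; split_ifs <;> simp
    calc _ ≤ ∫ _, (1 : ℝ) ∂μ := integral_mono (hZL i).integrable_sq (integrable_const _) this
      _ = 1 := by simp
  set S : Ω → ℝ := ∑ i, Z i with hS
  have hSL : MemLp S 2 μ := memLp_finsetSum' _ fun i _ => hZL i
  have hSE : μ[S] = n * q := by
    simp only [hS, Finset.sum_apply]
    rw [integral_finsetSum _ fun i _ => (hZL i).integrable (by norm_num)]
    simp only [hZE]; simp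
  have hSV : Var[S; μ] ≤ n := by
    rw [hS, IndepFun.variance_sum (fun i _ => hZL i)
      fun i _ j _ hij => hZind.indepFun hij]
    simpa using Finset.sum_le_card_nsmul Finset.univ _ _ fun i _ => hvar1 i
  have hn' : (0 : ℝ) < n := by exact_mod_cast hn
  have hcheb := meas_ge_le_variance_div_sq hSL (c := n * q / 2) (by positivity)
  have hsub : {ω | classProp (fun i => Y i ω) k < q / 2} ⊆ {ω | n * q / 2 ≤ |S ω - μ[S]|} := by
    intro ω hω
    simp only [Set.mem_ofPred_eq, classProp, classSize_eq_sum_indicator, div_lt_iff₀ hn'] at hω ⊢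
    have : S ω = ∑ i, ({ω | Y i ω = k} : Set Ω).indicator (fun _ => (1 : ℝ)) ω := by
      simp [hS, hZ]
    rw [hSE, this, abs_sub_comm]
    refine le_trans ?_ (le_abs_self _)
    linarith
  refine (measureReal_mono hsub).trans ?_
  rw [measureReal_def]
  refine (ENNReal.toReal_mono ENNReal.ofReal_ne_top hcheb).trans ?_
  rw [ENNReal.toReal_ofReal (div_nonneg (variance_nonneg _ _) (sq_nonneg _))]
  calc Var[S; μ] / (n * q / 2) ^ 2 ≤ n / (n * q / 2) ^ 2 := by gcongr
    _ = _ := by field_simp; norm_num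

variable {n : ℕ → ℕ} {Ω : ℕ → Type*} [∀ ν, MeasurableSpace (Ω ν)] {μ : ∀ ν, Measure (Ω ν)}
  [∀ ν, IsProbabilityMeasure (μ ν)] {Y : ∀ ν, Fin (n ν) → Ω ν → Fin K}

omit [∀ ν, IsProbabilityMeasure (μ ν)] in
/-- The total sample size tends to infinity if the class sizes do. -/
lemma tendsto_sampleSize (hK : 2 ≤ K)
    (hn : ∀ M : ℕ, Tendsto
      (fun ν => (μ ν).real {ω | ∀ k, M ≤ classSize (fun i => Y ν i ω) k}) atTop (𝓝 1)) :
    Tendsto n atTop atTop := by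
  refine tendsto_atTop.2 fun M => ?_
  -- Since `n ν` is not random, a single outcome with large classes bounds it from below; positive
  -- probability provides one.
  filter_upwards [(hn M).eventually (lt_mem_nhds (by norm_num : (0 : ℝ) < 1))] with ν hν
  have hne : {ω | ∀ k, M ≤ classSize (fun i => Y ν i ω) k}.Nonempty := by
    by_contra h
    rw [Set.not_nonempty_iff_eq_empty] at h
    rw [h] at hν
    simp at hν
  obtain ⟨ω, hω⟩ := hne
  refine (hω ⟨0, by omega⟩).trans ?_
  have : classSize (fun i => Y ν i ω) ⟨0, by omega⟩ ≤ Fintype.card (Fin (n ν)) :=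
    Finset.card_le_univ _
  rwa [Fintype.card_fin] at this

/-- In both sampling schemes, the class proportions stay away from zero. -/
lemma LabelSampling.exists_classProp_ge (hK : 2 ≤ K) (hYm : ∀ ν i, Measurable (Y ν i))
    (hYs : LabelSampling n μ Y) (hn : Tendsto n atTop atTop) :
    ∃ c : ℝ, 0 < c ∧
      Tendsto (fun ν => (μ ν).real {ω | ∀ k, c ≤ classProp (fun i => Y ν i ω) k}) atTop (𝓝 1) := by
  rcases hYs with ⟨hind, π, hπ, hlaw⟩ | h
  · have : Nonempty (Fin K) := ⟨⟨0, by omega⟩⟩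
    obtain ⟨k₀, hk₀⟩ := Finite.exists_min π
    -- Half the smallest class probability: a proportion below it is also below `π k / 2` for its
    -- own class, an event covered by Chebyshev's inequality.
    refine ⟨π k₀ / 2, by linarith [hπ k₀], ?_⟩
    have hlim : Tendsto (fun ν => 1 - ∑ k, 4 / ((n ν : ℝ) * π k ^ 2)) atTop (𝓝 1) := by
      have hk : ∀ k, Tendsto (fun ν => 4 / ((n ν : ℝ) * π k ^ 2)) atTop (𝓝 0) := fun k =>
        ((tendsto_natCast_atTop_atTop.comp hn).atTop_mul_const (pow_pos (hπ k) 2)).const_div_atTop 4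
      simpa using (tendsto_finsetSum Finset.univ fun k _ => hk k).const_sub 1
    refine tendsto_of_tendsto_of_tendsto_of_le_of_le' hlim tendsto_const_nhds ?_
      (Eventually.of_forall fun ν => measureReal_le_one)
    filter_upwards [hn.eventually_gt_atTop 0] with ν hν
    have hmeas : MeasurableSet {ω | ∀ k, π k₀ / 2 ≤ classProp (fun i => Y ν i ω) k} := by
      have hv : Measurable fun ω i => Y ν i ω := measurable_pi_lambda _ (hYm ν)
      exact hv (t := {y | ∀ k, π k₀ / 2 ≤ classProp y k}) (Set.toFinite _).measurableSet
    have hcompl := probReal_compl_eq_one_sub (μ := μ ν) hmeas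
    have hb : (μ ν).real {ω | ∀ k, π k₀ / 2 ≤ classProp (fun i => Y ν i ω) k}ᶜ ≤
        ∑ k, 4 / ((n ν : ℝ) * π k ^ 2) := by
      have hsub : {ω | ∀ k, π k₀ / 2 ≤ classProp (fun i => Y ν i ω) k}ᶜ ⊆
          ⋃ k, {ω | classProp (fun i => Y ν i ω) k < π k / 2} := by
        intro ω hω
        simp only [Set.mem_compl_iff, Set.mem_ofPred_eq, not_forall, not_le, Set.mem_iUnion] at hω ⊢
        obtain ⟨k, hk⟩ := hω
        exact ⟨k, hk.trans_le (by linarith [hk₀ k])⟩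
      refine (measureReal_mono hsub).trans ((measureReal_iUnion_fintype_le _).trans ?_)
      exact Finset.sum_le_sum fun k _ =>
        measureReal_classProp_lt_le hν (hYm ν) (hind ν) (hπ k) fun i => hlaw ν i k
    linarith
  · exact h

end Labels

/-- The iterated limit: `ν` tends to infinity for fixed `ε`, and only then `ε` tends to zero. -/
lemma tendsto_of_forall_norm_le {f : ℕ → ℂ} {L : ℂ} {e : ℝ → ℝ}
    (he : Tendsto e (𝓝[>] 0) (𝓝 0))
    (h : ∀ ε > 0, ∃ b : ℕ → ℝ, Tendsto b atTop (𝓝 (e ε)) ∧ ∀ᶠ ν in atTop, ‖f ν - L‖ ≤ b ν) :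
    Tendsto f atTop (𝓝 L) := by
  rw [tendsto_iff_norm_sub_tendsto_zero]
  refine NormedAddGroup.tendsto_nhds_zero.2 fun η hη => ?_
  obtain ⟨ε, hε1, hε0⟩ := ((he.eventually (gt_mem_nhds hη)).and self_mem_nhdsWithin).exists
  obtain ⟨b, hb, hfb⟩ := h ε hε0
  filter_upwards [hfb, hb.eventually (gt_mem_nhds hε1)] with ν h1 h2
  rw [norm_norm]
  exact h1.trans_lt h2

/-- At `B = 0` all terms with `ε⁻¹` disappear and a polynomial without constant term remains. -/
lemma tendsto_normalApproxError_zero (t : ℝ) :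
    Tendsto (fun ε => normalApproxError t ε 0) (𝓝[>] 0) (𝓝 0) := by
  have h : Tendsto (fun ε : ℝ => 2 * |t| ^ 3 * ε + (2 * |t| ^ 3 * ε + t ^ 2) * ε) (𝓝 0) (𝓝 0) := by
    have : Continuous fun ε : ℝ => 2 * |t| ^ 3 * ε + (2 * |t| ^ 3 * ε + t ^ 2) * ε := by fun_prop
    simpa using this.tendsto 0
  refine (h.mono_left nhdsWithin_le_nhds).congr fun ε => ?_
  simp [normalApproxError]

/-! ### Samples with random labels -/

section Sample

lemma map_sample_eq {n : ℕ} {E Ω : Type*} [MeasurableSpace E] [MeasurableSpace Ω] {μ : Measure Ω}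
    [IsProbabilityMeasure μ] {F : Measure E} [IsProbabilityMeasure F] {X : Fin n → Ω → E}
    (hXm : ∀ i, Measurable (X i)) (hXlaw : ∀ i, μ.map (X i) = F) (hXindep : iIndepFun X μ) :
    μ.map (fun ω i => X i ω) = sampleLaw (Fin n) F := by
  rw [(iIndepFun_iff_map_fun_eq_pi_map fun i => (hXm i).aemeasurable).1 hXindep]
  simp only [hXlaw]

/-- The variance of the Gini covariance given the labels. -/
lemma variance_gCov_cond {p n K : ℕ} {F : Measure (EuclideanSpace ℝ (Fin p))}
    [IsProbabilityMeasure F] {Ω : Type*} [MeasurableSpace Ω] {μ : Measure Ω}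
    [IsProbabilityMeasure μ] {X : Fin n → Ω → EuclideanSpace ℝ (Fin p)} {Y : Fin n → Ω → Fin K}
    (hF : Integrable (fun x => ‖x‖ ^ 4) F) (hK : 2 ≤ K)
    (hX : Measurable fun ω i => X i ω) (hY : Measurable fun ω i => Y i ω)
    (hlaw : μ.map (fun ω i => X i ω) = sampleLaw (Fin n) F)
    (hXY : IndepFun (fun ω i => X i ω) (fun ω i => Y i ω) μ)
    {y : Fin n → Fin K} (hy : ∀ k, 2 ≤ classSize y k)
    (h0 : μ ((fun ω i => Y i ω) ⁻¹' {y}) ≠ 0) :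
    Var[fun ω => gCov (fun i => X i ω) (fun i => Y i ω); μ[|(fun ω i => Y i ω) ⁻¹' {y}]] =
      sigmaSq F y := by
  have hmap := map_cond_eq_of_indepFun hX hY hXY (measurableSet_singleton y) h0
  rw [hlaw] at hmap
  rw [← variance_gCov hF hK hy, ← hmap, variance_map (measurable_gCov y).aemeasurable
    hX.aemeasurable]
  refine variance_congr ?_
  filter_upwards [ae_cond_mem (μ := μ) (hY (measurableSet_singleton y))] with ω hω
  have hy' : (fun i => Y i ω) = y := hω
  simp only [Function.comp, hy']

lemma measurable_gCov_div_comp {p n K : ℕ} (F : Measure (EuclideanSpace ℝ (Fin p)))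
    {Ω : Type*} [MeasurableSpace Ω] {X : Fin n → Ω → EuclideanSpace ℝ (Fin p)}
    {Y : Fin n → Ω → Fin K}
    (hX : Measurable fun ω i => X i ω) (hY : Measurable fun ω i => Y i ω) :
    Measurable fun ω => gCov (fun i => X i ω) (fun i => Y i ω) /
      √(sigmaSq F (fun i => Y i ω)) := by
  have h := (measurable_gCov_div F).comp (hX.prodMk hY)
  exact h

lemma dcMoment_four_nonneg {p : ℕ} (F : Measure (EuclideanSpace ℝ (Fin p))) :
    0 ≤ dcMoment F 4 := by
  unfold dcMoment
  refine integral_nonneg fun w => ?_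
  exact Even.pow_nonneg (by decide) _

/-- The normal approximation of the Gini covariance of a sample with random labels. -/
lemma norm_charFun_map_gCov_sub_le {p n K : ℕ} {F : Measure (EuclideanSpace ℝ (Fin p))}
    [IsProbabilityMeasure F] {Ω : Type*} [MeasurableSpace Ω] {μ : Measure Ω}
    [IsProbabilityMeasure μ] {X : Fin n → Ω → EuclideanSpace ℝ (Fin p)} {Y : Fin n → Ω → Fin K}
    (hF : Integrable (fun x => ‖x‖ ^ 4) F) (hpos : 0 < dcMoment F 2) (hK : 2 ≤ K)
    (hX : Measurable fun ω i => X i ω) (hY : Measurable fun ω i => Y i ω)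
    (hlaw : μ.map (fun ω i => X i ω) = sampleLaw (Fin n) F)
    (hXY : IndepFun (fun ω i => X i ω) (fun ω i => Y i ω) μ)
    {c : ℝ} (hc0 : 0 < c) (hcn : 2 ≤ c * n) (t : ℝ) {ε B : ℝ} (hε : 0 < ε)
    (hB4 : 64 / c ^ 6 * (dcMoment F 4 / (n * dcMoment F 2 ^ 2)) ≤ B)
    (hBg : 64 / c ^ 6 * (dcCycle F / dcMoment F 2 ^ 2) ≤ B) :
    ‖charFun (μ.map fun ω => gCov (fun i => X i ω) (fun i => Y i ω) /
        √(sigmaSq F (fun i => Y i ω))) t - (Real.exp (-(t ^ 2 / 2)) : ℝ)‖ ≤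
      normalApproxError t ε B + 2 * (1 - μ.real {ω | ∀ k, c ≤ classProp (fun i => Y i ω) k}) := by
  have hm := measurable_gCov_div (n := n) (K := K) F
  have hT := measurable_gCov_div_comp F hX hY
  have h4 : 0 ≤ dcMoment F 4 := dcMoment_four_nonneg F
  have hB : 0 ≤ B := (mul_nonneg (div_nonneg (by norm_num) (pow_nonneg hc0.le 6))
    (div_nonneg h4 (mul_nonneg (Nat.cast_nonneg n) (sq_nonneg _)))).trans hB4
  have key := norm_integral_indep_sub_le hX hY hXY
    (g := fun w => Complex.exp ((t * (gCov w.1 w.2 / √(sigmaSq F w.2)) : ℝ) * Complex.I))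
    (by fun_prop) (fun w => (Complex.norm_exp_ofReal_mul_I _).le)
    (L := ((Real.exp (-(t ^ 2 / 2)) : ℝ) : ℂ))
    (by
      rw [Complex.norm_real, Real.norm_of_nonneg (Real.exp_pos _).le, Real.exp_le_one_iff]
      linarith [sq_nonneg t])
    (G := {y | ∀ k, c ≤ classProp y k}) (Set.toFinite _).measurableSet
    (b := normalApproxError t ε B) (by unfold normalApproxError; positivity)
    (fun y hy => by
      rw [hlaw]
      exact norm_charFun_gCov_sub_le hF hpos hK hc0 hy hcn t hε hB4 hBg)
  have e : charFun (μ.map fun ω => gCov (fun i => X i ω) (fun i => Y i ω) /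
      √(sigmaSq F (fun i => Y i ω))) t = ∫ ω, Complex.exp ((t * (gCov (fun i => X i ω)
        (fun i => Y i ω) / √(sigmaSq F (fun i => Y i ω))) : ℝ) * Complex.I) ∂μ := by
    rw [charFun_apply_real, integral_map hT.aemeasurable (by fun_prop)]
    simp only [Complex.ofReal_mul]
  rw [e]
  exact key

end Sample

end GiniCov

end

/-! ### The limit theorem -/

theorem theorem1
    -- a fixed number of classes
    (K : ℕ) (hK : 2 ≤ K)
    -- dimensions, total sample sizes and laws of the numerical variable along a sequence
    (p n : ℕ → ℕ)
    (F : ∀ ν, Measure (EuclideanSpace ℝ (Fin (p ν)))) [∀ ν, IsProbabilityMeasure (F ν)]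
    -- the samples: the `X ν i` are i.i.d. of law `F ν`, and independent of the labels
    {Ω : ℕ → Type*} [∀ ν, MeasurableSpace (Ω ν)]
    (μ : ∀ ν, Measure (Ω ν)) [∀ ν, IsProbabilityMeasure (μ ν)]
    (X : ∀ ν, Fin (n ν) → Ω ν → EuclideanSpace ℝ (Fin (p ν)))
    (Y : ∀ ν, Fin (n ν) → Ω ν → Fin K)
    (hXm : ∀ ν i, Measurable (X ν i)) (hYm : ∀ ν i, Measurable (Y ν i))
    (hXlaw : ∀ ν i, (μ ν).map (X ν i) = F ν)
    (hXindep : ∀ ν, iIndepFun (X ν) (μ ν))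
    (hXY : ∀ ν, IndepFun (fun ω i => X ν i ω) (fun ω i => Y ν i ω) (μ ν))
    (hYs : GiniCov.LabelSampling n μ Y)
    -- moment conditions; the denominators of the ratios are nonzero
    (hC1 : ∀ ν, Integrable (fun x => ‖x‖ ^ 4) (F ν))
    (hpos : ∀ ν, 0 < GiniCov.dcMoment (F ν) 2)
    (hC2 : Tendsto (fun ν => GiniCov.dcMoment (F ν) 4 /
      ((n ν : ℝ) * GiniCov.dcMoment (F ν) 2 ^ 2)) atTop (𝓝 0))
    (hC3 : Tendsto (fun ν => GiniCov.dcCycle (F ν) / GiniCov.dcMoment (F ν) 2 ^ 2)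
      atTop (𝓝 0))
    -- the smallest class size tends to infinity (in probability), and so does the dimension
    (hn : ∀ M : ℕ, Tendsto
      (fun ν => (μ ν).real {ω | ∀ k, M ≤ GiniCov.classSize (fun i => Y ν i ω) k}) atTop (𝓝 1))
    (hp : Tendsto p atTop atTop) :
    -- asymptotic normality
    TendstoInDistribution
      (fun ν ω => GiniCov.gCov (fun i => X ν i ω) (fun i => Y ν i ω) /
        √(GiniCov.sigmaSq (F ν) (fun i => Y ν i ω)))
      atTop (id : ℝ → ℝ) μ (gaussianReal 0 1) ∧
    -- `σ₀²` is the variance of the sample Gini covariance given the labels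
    ∀ ν (y : Fin (n ν) → Fin K), (∀ k, 2 ≤ GiniCov.classSize y k) →
      μ ν ((fun ω i => Y ν i ω) ⁻¹' {y}) ≠ 0 →
      Var[fun ω => GiniCov.gCov (fun i => X ν i ω) (fun i => Y ν i ω);
        (μ ν)[|(fun ω i => Y ν i ω) ⁻¹' {y}]] = GiniCov.sigmaSq (F ν) y := by
  have hn' := GiniCov.tendsto_sampleSize hK hn
  obtain ⟨c, hc0, hc⟩ := hYs.exists_classProp_ge hK hYm hn'
  have hXv : ∀ ν, Measurable fun ω i => X ν i ω := fun ν => measurable_pi_lambda _ (hXm ν)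
  have hYv : ∀ ν, Measurable fun ω i => Y ν i ω := fun ν => measurable_pi_lambda _ (hYm ν)
  have hlaw := fun ν => GiniCov.map_sample_eq (hXm ν) (hXlaw ν) (hXindep ν)
  refine ⟨⟨fun ν => (GiniCov.measurable_gCov_div_comp (F ν) (hXv ν) (hYv ν)).aemeasurable, aemeasurable_id, ?_⟩, fun ν y hy h0 =>
    GiniCov.variance_gCov_cond (hC1 ν) hK (hXv ν) (hYv ν) (hlaw ν) (hXY ν) hy h0⟩
  refine ProbabilityMeasure.tendsto_iff_tendsto_charFun.2 fun t => ?_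
  simp only [ProbabilityMeasure.coe_mk, Measure.map_id, charFun_gaussianReal]
  have hL : Complex.exp (t * (0 : ℝ) * Complex.I - (1 : NNReal) * t ^ 2 / 2) =
      ((Real.exp (-(t ^ 2 / 2)) : ℝ) : ℂ) := by
    push_cast
    congr 1
    simp
  rw [hL]
  refine GiniCov.tendsto_of_forall_norm_le (GiniCov.tendsto_normalApproxError_zero t) fun ε hε => ?_
  -- A common bound for the multiples of the ratios in (C2) and (C3); it tends to zero, whereas `ε`
  -- stays fixed.
  set B : ℕ → ℝ := fun ν =>
    max (64 / c ^ 6 * (GiniCov.dcMoment (F ν) 4 / (n ν * GiniCov.dcMoment (F ν) 2 ^ 2)))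
      (64 / c ^ 6 * (GiniCov.dcCycle (F ν) / GiniCov.dcMoment (F ν) 2 ^ 2))
  have hB0 : Tendsto B atTop (𝓝 0) := by
    simpa using (hC2.const_mul (64 / c ^ 6)).max (hC3.const_mul (64 / c ^ 6))
  refine ⟨fun ν => GiniCov.normalApproxError t ε (B ν) + 2 * (1 - (μ ν).real
    {ω | ∀ k, c ≤ GiniCov.classProp (fun i => Y ν i ω) k}), ?_, ?_⟩
  · have hcont : Continuous fun b : ℝ => GiniCov.normalApproxError t ε b := by
      unfold GiniCov.normalApproxError; fun_prop
    simpa using ((hcont.tendsto 0).comp hB0).add ((hc.const_sub 1).const_mul 2)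
  -- Once $cn\ge2$, proportions of at least `c` guarantee two members in every class.
  · filter_upwards [((tendsto_natCast_atTop_atTop.comp hn').const_mul_atTop
      hc0).eventually_ge_atTop 2] with ν hν
    exact GiniCov.norm_charFun_map_gCov_sub_le (hC1 ν) (hpos ν) hK (hXv ν) (hYv ν) (hlaw ν)
      (hXY ν) hc0 hν t hε (le_max_left _ _) (le_max_right _ _)
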